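/- **Theorem 1.** Write $(a;b)_\infty=\prod_{k\ge 0}(1-ab^k)$ and $(a)_\infty=(a;q)_\infty$. The rank of a partition is its largest part minus its number of parts. The crank of a partition with exactly $\omega$ parts equal to $1$ is its largest part if $\omega=0$, and the number of parts larger than $\omega$, minus $\omega$, if $\omega>0$. Let $N(m,n)$ be the number of partitions of $n$ with rank $m$. For $n\neq 1$ let $M(m,n)$ be the number of partitions of $n$ with crank $m$, and for $n=1$ put, as usual, $M(0,1)=-1$, $M(1,1)=M(-1,1)=1$ and $M(m,1)=0$ for all other $m$. Let $N_2(n)=\sum_{m\in\mathbb Z}m^2N(m,n)$ and $M_2(n)=\sum_{m\in\mathbb Z}m^2M(m,n)$. Then the following identities hold between formal power series in $q$ with rational coefficients, where all infinite sums and products converge coefficientwise: $$\sum_{n\ge1}\frac{q^n(q^{2n+1};q^2)_{\infty}}{(1-q^n)^2(q^{n+1})_{\infty}}=\frac{1}{(q^2;q^2)_{\infty}}\sum_{n\ge1}\frac{nq^n}{1-q^n}-\frac{1}{2}\sum_{n\ge1}N_2(n)q^{2n},$$ $$\sum_{n\ge1}\frac{q^{n(n+1)/2}(q^{2n+1};q^2)_{\infty}}{(1-q^n)^2(q^{n+1})_{\infty}}=\frac{1}{(q^2;q^2)_{\infty}}\sum_{n\ge1}\frac{nq^n}{1-q^n}-\frac{1}{2}\sum_{n\ge1}M_2(n)q^{2n}.$$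 -/

import Mathlib

open PowerSeries
open scoped PowerSeries.WithPiTopology

/-- The infinite `q`-shifted factorial `(a; b)_∞ = ∏_{k ≥ 0} (1 - a b^k)` in `ℚ⟦X⟧`, where the
infinite product is taken coefficientwise. -/
noncomputable def qPochInf (a b : ℚ⟦X⟧) : ℚ⟦X⟧ := ∏' k : ℕ, (1 - a * b ^ k)

/-- The product defining `(a; b)_∞` converges whenever `b` has zero constant term. -/
theorem qPochInf_multipliable (a b : ℚ⟦X⟧) (hb : constantCoeff b = 0) :
    Multipliable (fun k : ℕ => 1 - a * b ^ k) := by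
  have h : Multipliable (fun k : ℕ => 1 + (-(a * b ^ k))) := by
    apply WithPiTopology.multipliable_one_add_of_tendsto_order_atTop_nhds_top
    rw [ENat.tendsto_nhds_top_iff_natCast_lt]
    intro m
    filter_upwards [Filter.eventually_gt_atTop m] with k hk
    have h1 : ((k : ℕ) : ℕ∞) ≤ (b ^ k).order := by
      apply nat_le_order
      intro i hi
      exact coeff_of_lt_order i (lt_of_lt_of_le (by exact_mod_cast hi)
        (le_order_pow_of_constantCoeff_eq_zero k hb))
    rw [order_neg]
    calc (m : ℕ∞) < k := by exact_mod_cast hk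
      _ ≤ (b ^ k).order := h1
      _ ≤ a.order + (b ^ k).order := le_add_self
      _ ≤ (a * b ^ k).order := le_order_mul _ _
  simpa [sub_eq_add_neg] using h

namespace Nat.Partition

/-- The largest part of a partition (`0` for the empty partition). -/
def largestPart {n : ℕ} (p : n.Partition) : ℕ := p.parts.sup

/-- Dyson's rank: the largest part minus the number of parts. -/
def rank {n : ℕ} (p : n.Partition) : ℤ := (p.largestPart : ℤ) - (p.parts.card : ℤ)

/-- The Andrews–Garvan crank: if `ω` is the number of ones in `p`, the crank is the largest part
when `ω = 0`, and the number of parts larger than `ω` minus `ω` when `ω > 0`. -/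
def crank {n : ℕ} (p : n.Partition) : ℤ :=
  if p.parts.count 1 = 0 then (p.largestPart : ℤ)
  else ((p.parts.filter (fun k => p.parts.count 1 < k)).card : ℤ) - (p.parts.count 1 : ℤ)

end Nat.Partition

/-- `N(m, n)`: the number of partitions of `n` with rank `m`. -/
def rankCount (m : ℤ) (n : ℕ) : ℤ :=
  ((Finset.univ.filter (fun p : n.Partition => p.rank = m)).card : ℤ)

/-- `M(m, n)`: the number of partitions of `n` with crank `m`, with the standard convention
`M(0, 1) = -1`, `M(1, 1) = M(-1, 1) = 1` and `M(m, 1) = 0` otherwise, for `n = 1`. -/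
def crankCount (m : ℤ) (n : ℕ) : ℤ :=
  if n = 1 then (if m = 0 then -1 else if m = 1 ∨ m = -1 then 1 else 0)
  else ((Finset.univ.filter (fun p : n.Partition => p.crank = m)).card : ℤ)

/-- Only finitely many `m` contribute to the moments of the rank. -/
theorem rankCount_support_finite (n : ℕ) :
    (Function.support fun m : ℤ => m ^ 2 * rankCount m n).Finite := by
  refine (Finset.univ.image (fun p : n.Partition => p.rank)).finite_toSet.subset ?_
  intro m hm
  by_contra h
  apply hm
  have : (Finset.univ.filter (fun p : n.Partition => p.rank = m)) = ∅ := by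
    ext p; simp at h ⊢; exact h p
  simp [rankCount, this]

/-- Only finitely many `m` contribute to the moments of the crank. -/
theorem crankCount_support_finite (n : ℕ) :
    (Function.support fun m : ℤ => m ^ 2 * crankCount m n).Finite := by
  by_cases hn : n = 1
  · refine ({1, -1} : Finset ℤ).finite_toSet.subset ?_
    intro m hm
    by_contra h
    apply hm
    have h' : ¬ (m = 1 ∨ m = -1) := by simpa using h
    by_cases h0 : m = 0 <;> simp [crankCount, hn, h0, h']
  · refine (Finset.univ.image (fun p : n.Partition => p.crank)).finite_toSet.subset ?_
    intro m hm
    by_contra h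
    apply hm
    have : (Finset.univ.filter (fun p : n.Partition => p.crank = m)) = ∅ := by
      ext p; simp at h ⊢; exact h p
    simp [crankCount, hn, this]

/-- The second rank moment `N₂(n) = ∑_{m ∈ ℤ} m² N(m, n)`; the sum has finite support. -/
noncomputable def rankMoment2 (n : ℕ) : ℤ := ∑ᶠ m : ℤ, m ^ 2 * rankCount m n

/-- The second crank moment `M₂(n) = ∑_{m ∈ ℤ} m² M(m, n)`; the sum has finite support. -/
noncomputable def crankMoment2 (n : ℕ) : ℤ := ∑ᶠ m : ℤ, m ^ 2 * crankCount m n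

/-
Both left-hand sides are instances of one Bailey-type identity relative to `a = 1`: pairing the
conjugate Bailey pair whose `δ`-sequence is `δ_n = (q)_n² q^n / (1 - q^n)²` with the unit Bailey
pair (or its first iterate) in base `q²`, spread over the even indices, yields
`(q²; q²)_∞⁻¹ (∑ n q^n / (1 - q^n) - S(q²))`, where `S` is a Lambert-type series. It remains to
recognise `(q)_∞⁻¹ S(q)` as half the second moment generating function. For this the two-variable
rank and crank generating functions are evaluated at `z` and `z⁻¹` in a ring of iterated dual
numbers where `(z + z⁻¹ - 2)² = 0`. The Rogers–Fine recurrence and the Bailey lemma (for the rank)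
and the `q`-binomial theorem (for the crank) expand them to first order in `z + z⁻¹ - 2`, and the
coefficient there is half the second moment.
-/

open scoped Ring
open Finset

section QPochhammer

variable {A : Type*} [CommRing A]

theorem mul_inverse_mul_cancel_left {a : A} (ha : IsUnit a) (b : A) : a * (a * b)⁻¹ʳ = b⁻¹ʳ := by
  rw [Ring.inverse_mul (.inl ha), mul_left_comm, Ring.mul_inverse_cancel a ha, mul_one]

/-- The finite `q`-shifted factorial `(a; q)_n`. -/
def qPochhammer (a q : A) (n : ℕ) : A := ∏ i ∈ range n, (1 - a * q ^ i)

@[simp]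
theorem qPochhammer_zero (a q : A) : qPochhammer a q 0 = 1 := prod_range_zero _

theorem qPochhammer_succ (a q : A) (n : ℕ) :
    qPochhammer a q (n + 1) = qPochhammer a q n * (1 - a * q ^ n) := prod_range_succ _ _

theorem qPochhammer_succ' (a q : A) (n : ℕ) :
    qPochhammer a q (n + 1) = (1 - a) * qPochhammer (a * q) q n := by
  simp only [qPochhammer, prod_range_succ', pow_zero, mul_one, pow_succ', mul_assoc, mul_comm]

theorem qPochhammer_add (a q : A) (m n : ℕ) :
    qPochhammer a q (m + n) = qPochhammer a q m * qPochhammer (a * q ^ m) q n := by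
  simp only [qPochhammer, prod_range_add, pow_add, mul_assoc]

theorem qPochhammer_self_succ (q : A) (n : ℕ) :
    qPochhammer q q (n + 1) = qPochhammer q q n * (1 - q ^ (n + 1)) := by
  rw [qPochhammer_succ, pow_succ']

theorem isUnit_qPochhammer {a q : A} {n : ℕ} (h : ∀ i < n, IsUnit (1 - a * q ^ i)) :
    IsUnit (qPochhammer a q n) := by
  induction n with
  | zero => simp
  | succ n ih =>
    rw [qPochhammer_succ]
    exact (ih fun i hi => h i (by omega)).mul (h n (by omega))

variable {q : A} (hq : ∀ n, IsUnit (1 - q ^ (n + 1)))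
include hq

theorem isUnit_qPochhammer_self (n : ℕ) : IsUnit (qPochhammer q q n) :=
  isUnit_qPochhammer fun i _ => by simpa only [pow_succ'] using hq i

theorem isUnit_qPochhammer_sq (n : ℕ) : IsUnit (qPochhammer q (q ^ 2) n) :=
  isUnit_qPochhammer fun i _ => by simpa only [pow_succ', pow_mul] using hq (2 * i)

end QPochhammer

section BaileyPair

variable {A : Type*} [CommRing A]

/-- The entry `1 / ((q; q)_{n - r} (q; q)_{n + r})` of the (infinite, lower triangular) Bailey
matrix. -/
noncomputable def baileyCoeff (q : A) (n r : ℕ) : A :=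
  if r ≤ n then (qPochhammer q q (n - r) * qPochhammer q q (n + r))⁻¹ʳ else 0

/-- `(α, β)` is a Bailey pair relative to `a = 1`. -/
def IsBaileyPair (q : A) (α β : ℕ → A) : Prop :=
  ∀ n, β n = ∑ r ∈ range (n + 1), α r * baileyCoeff q n r

theorem baileyCoeff_of_lt (q : A) {n r : ℕ} (h : n < r) : baileyCoeff q n r = 0 :=
  if_neg h.not_ge

theorem baileyCoeff_add_right (q : A) (m r : ℕ) :
    baileyCoeff q (m + r) r = (qPochhammer q q m * qPochhammer q q (m + r + r))⁻¹ʳ := by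
  simp [baileyCoeff]

theorem baileyCoeff_zero_right (q : A) (n : ℕ) :
    baileyCoeff q n 0 = (qPochhammer q q n * qPochhammer q q n)⁻¹ʳ := by
  simp [baileyCoeff]

theorem IsBaileyPair.eq_sum_range {q : A} {α β : ℕ → A} (h : IsBaileyPair q α β) {n m : ℕ}
    (hnm : n < m) : β n = ∑ r ∈ range m, α r * baileyCoeff q n r := by
  rw [h n]
  refine sum_subset (range_mono hnm) fun r _ hr => ?_
  rw [baileyCoeff_of_lt q (by simpa using hr), mul_zero]

variable {q : A} (hq : ∀ n, IsUnit (1 - q ^ (n + 1)))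
include hq

theorem baileyCoeff_eq_mul_baileyCoeff_succ_left (n r : ℕ) :
    baileyCoeff q n r
      = (1 - q ^ (n + 1 - r)) * (1 - q ^ (n + 1 + r)) * baileyCoeff q (n + 1) r := by
  rcases lt_or_ge n r with h | h
  · rw [baileyCoeff_of_lt q h, Nat.sub_eq_zero_of_le h, pow_zero, sub_self, zero_mul, zero_mul]
  obtain ⟨m, rfl⟩ := Nat.exists_eq_add_of_le' h
  have hu : IsUnit ((1 - q ^ (m + 1)) * (1 - q ^ (m + r + 1 + r))) := by
    rw [add_right_comm]
    exact (hq _).mul (hq _)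
  rw [baileyCoeff_add_right, ← mul_inverse_mul_cancel_left hu,
    show m + r + 1 = m + 1 + r by ring, baileyCoeff_add_right, Nat.add_sub_cancel,
    show m + 1 + r + r = m + r + r + 1 by ring, qPochhammer_self_succ, qPochhammer_self_succ]
  ring_nf

theorem one_sub_mul_baileyCoeff_eq (n r : ℕ) :
    (1 - q ^ (n - r)) * baileyCoeff q n r
      = (1 - q ^ (n + r + 1)) * baileyCoeff q n (r + 1) := by
  rcases le_or_gt n r with h | h
  · rw [baileyCoeff_of_lt q (Nat.lt_succ_of_le h), Nat.sub_eq_zero_of_le h, pow_zero, sub_self,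
      zero_mul, mul_zero]
  obtain ⟨m, rfl⟩ := Nat.exists_eq_add_of_le' h
  rw [baileyCoeff_add_right, show m + (r + 1) - r = m + 1 by omega,
    show m + (r + 1) = m + 1 + r by ring, baileyCoeff_add_right,
    show m + 1 + r + (r + 1) = m + 1 + r + r + 1 by ring, qPochhammer_self_succ q m,
    qPochhammer_self_succ q (m + 1 + r + r)]
  rw [mul_comm (qPochhammer q q m), mul_assoc, mul_inverse_mul_cancel_left (hq m),
    ← mul_assoc, mul_comm _ (1 - q ^ (m + 1 + r + r + 1)), mul_inverse_mul_cancel_left (hq _)]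

end BaileyPair

section UnitPair

variable {A : Type*} [CommRing A]

/-- The sequence `α` of the unit Bailey pair, whose `β` is `1, 0, 0, …`. -/
def unitAlpha (q : A) : ℕ → A
  | 0 => 1
  | r + 1 => (-1) ^ (r + 1) * q ^ (r + 1).choose 2 * (1 + q ^ (r + 1))

/-- The sequence `a 0, 0, a 1, 0, a 2, 0, …`. -/
def evenSeq (a : ℕ → A) (r : ℕ) : A := if Even r then a (r / 2) else 0

theorem sum_range_evenSeq_mul (a f : ℕ → A) (n : ℕ) :
    ∑ r ∈ range (2 * n), evenSeq a r * f r = ∑ s ∈ range n, a s * f (2 * s) := by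
  induction n with
  | zero => simp
  | succ n ih =>
    rw [show 2 * (n + 1) = 2 * n + 1 + 1 by ring, sum_range_succ, sum_range_succ, ih,
      sum_range_succ]
    simp [evenSeq]

theorem IsBaileyPair.of_evenSeq {q : A} {a β : ℕ → A}
    (h : ∀ n, β n = ∑ s ∈ range (n + 1), a s * baileyCoeff q n (2 * s)) :
    IsBaileyPair q (evenSeq a) β := by
  intro n
  rw [h n, ← sum_range_evenSeq_mul]
  refine (sum_subset (range_mono (by omega)) fun r _ hr => ?_).symm
  rw [baileyCoeff_of_lt q (by simpa using hr), mul_zero]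

variable {q : A} (hq : ∀ n, IsUnit (1 - q ^ (n + 1)))
include hq

theorem one_sub_mul_sum_unitAlpha (n R : ℕ) :
    (1 - q ^ n) * ∑ r ∈ range (R + 1), unitAlpha q r * baileyCoeff q n r
      = (-1) ^ R * q ^ (R + 1).choose 2 * ((1 - q ^ (n - R)) * baileyCoeff q n R) := by
  induction R with
  | zero => simp [unitAlpha]
  | succ R ih =>
    rw [sum_range_succ, mul_add, ih, one_sub_mul_baileyCoeff_eq hq]
    rcases lt_or_ge n (R + 1) with h | h
    · simp [baileyCoeff_of_lt q h]
    obtain ⟨m, rfl⟩ := Nat.exists_eq_add_of_le' h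
    rw [Nat.add_sub_cancel, Nat.choose_succ_succ' (R + 1) 1, Nat.choose_one_right, unitAlpha]
    ring

theorem isBaileyPair_unit : IsBaileyPair q (unitAlpha q) fun n => if n = 0 then 1 else 0 := by
  rintro (_ | n)
  · simp [unitAlpha, baileyCoeff]
  · have h := one_sub_mul_sum_unitAlpha hq (n + 1) (n + 1)
    rw [Nat.sub_self, pow_zero, sub_self, zero_mul, mul_zero] at h
    simpa using ((hq n).mul_right_eq_zero.1 h).symm

theorem eq_prod_mul_inverse_of_recurrence {B c : ℕ → A} (h0 : B 0 = 1)
    (h : ∀ n, (1 - q ^ (n + 1)) * (1 - q ^ (2 * n + 1)) * B (n + 1) = c n * B n) (n : ℕ) :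
    B n = (∏ i ∈ range n, c i) * (qPochhammer q q n * qPochhammer q (q ^ 2) n)⁻¹ʳ := by
  rw [Ring.eq_mul_inverse_iff_mul_eq _ _ _
    ((isUnit_qPochhammer_self hq n).mul (isUnit_qPochhammer_sq hq n))]
  induction n with
  | zero => simp [h0]
  | succ n ih =>
    rw [prod_range_succ, ← ih, qPochhammer_self_succ, qPochhammer_succ]
    linear_combination qPochhammer q q n * qPochhammer q (q ^ 2) n * h n

theorem one_sub_mul_one_sub_mul_baileyCoeff_eq (n r : ℕ) :
    (1 - q ^ (n - r)) * (1 - q ^ (n - (r + 1))) * baileyCoeff q n r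
      = (1 - q ^ (n + r + 1)) * (1 - q ^ (n + r + 2)) * baileyCoeff q n (r + 2) := by
  linear_combination (1 - q ^ (n - (r + 1))) * one_sub_mul_baileyCoeff_eq hq n r
    + (1 - q ^ (n + r + 1)) * one_sub_mul_baileyCoeff_eq hq n (r + 1)

theorem sum_unitAlpha_sq_telescope (n S : ℕ) :
    ∑ s ∈ range (S + 1), unitAlpha (q ^ 2) s *
        ((1 - q ^ (n + 1)) * (1 - q ^ (2 * n + 1)) * baileyCoeff q (n + 1) (2 * s)
          - q ^ n * baileyCoeff q n (2 * s))
      = (-1) ^ S * (q ^ 2) ^ (S + 1).choose 2 * ((1 - q ^ (n + 1 - 2 * S)) *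
          (1 - q ^ (n + 1 - (2 * S + 1))) * baileyCoeff q (n + 1) (2 * S)) := by
  induction S with
  | zero =>
    rw [sum_range_one, baileyCoeff_eq_mul_baileyCoeff_succ_left hq n]
    simp only [unitAlpha, mul_zero, tsub_zero, add_zero, one_mul, pow_zero, zero_add,
      Nat.choose_succ_self, mul_one, add_tsub_cancel_right]
    ring
  | succ S ih =>
    rw [sum_range_succ, ih, one_sub_mul_one_sub_mul_baileyCoeff_eq hq,
      baileyCoeff_eq_mul_baileyCoeff_succ_left hq n, show 2 * (S + 1) = 2 * S + 2 by ring]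
    rcases lt_or_ge (n + 1) (2 * S + 2) with h | h
    · simp [baileyCoeff_of_lt q h]
    rw [Nat.choose_succ_succ' (S + 1) 1, Nat.choose_one_right, unitAlpha]
    obtain ⟨m, hm⟩ := Nat.exists_eq_add_of_le' h
    obtain rfl : n = m + 2 * S + 1 := by omega
    rw [hm, Nat.add_sub_cancel]
    rcases m with _ | m
    · simp only [zero_add, pow_zero, sub_self, zero_mul, mul_zero]
      ring
    · rw [show m + 1 + (2 * S + 2) - (2 * S + 2 + 1) = m by omega]
      ring

theorem sum_mul_unitAlpha_sq_telescope (n S : ℕ) :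
    ∑ s ∈ range (S + 1), (q ^ 2) ^ s ^ 2 * unitAlpha (q ^ 2) s *
        ((1 - q ^ (n + 1)) * (1 - q ^ (2 * n + 1)) * baileyCoeff q (n + 1) (2 * s)
          - baileyCoeff q n (2 * s))
      = (-1) ^ S * q ^ (6 * (S + 1).choose 2 + n + 1) * ((1 - q ^ (n + 1 - 2 * S)) *
          (1 - q ^ (n + 1 - (2 * S + 1))) * baileyCoeff q (n + 1) (2 * S)) := by
  induction S with
  | zero =>
    rw [sum_range_one, baileyCoeff_eq_mul_baileyCoeff_succ_left hq n]
    simp only [ne_eq, OfNat.ofNat_ne_zero, not_false_eq_true, zero_pow, pow_zero, unitAlpha,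
      mul_one, mul_zero, tsub_zero, add_zero, one_mul, zero_add, Nat.choose_succ_self,
      add_tsub_cancel_right]
    ring
  | succ S ih =>
    rw [sum_range_succ, ih, one_sub_mul_one_sub_mul_baileyCoeff_eq hq,
      baileyCoeff_eq_mul_baileyCoeff_succ_left hq n, show 2 * (S + 1) = 2 * S + 2 by ring]
    rcases lt_or_ge (n + 1) (2 * S + 2) with h | h
    · simp [baileyCoeff_of_lt q h]
    have hchoose : (q ^ 2) ^ (S + 1) ^ 2
        = q ^ (4 * (S + 1).choose 2) * q ^ (2 * (S + 1)) := by
      have := Nat.add_one_mul_choose_eq S 1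
      rw [Nat.choose_one_right] at this
      rw [← pow_mul, ← pow_add]
      congr 1
      linear_combination 2 * this
    rw [hchoose, Nat.choose_succ_succ' (S + 1) 1, Nat.choose_one_right, unitAlpha]
    obtain ⟨m, hm⟩ := Nat.exists_eq_add_of_le' h
    obtain rfl : n = m + 2 * S + 1 := by omega
    rw [hm, Nat.add_sub_cancel]
    rcases m with _ | m
    · simp only [zero_add, pow_zero, sub_self, zero_mul, mul_zero]
      ring
    · rw [show m + 1 + (2 * S + 2) - (2 * S + 2 + 1) = m by omega]
      ring

theorem IsBaileyPair.of_telescope {a c : ℕ → A} (ha : a 0 = 1)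
    (h : ∀ n, ∑ s ∈ range (n + 2), a s *
      ((1 - q ^ (n + 1)) * (1 - q ^ (2 * n + 1)) * baileyCoeff q (n + 1) (2 * s)
        - c n * baileyCoeff q n (2 * s)) = 0) :
    IsBaileyPair q (evenSeq a)
      fun n => (∏ i ∈ range n, c i) * (qPochhammer q q n * qPochhammer q (q ^ 2) n)⁻¹ʳ := by
  refine .of_evenSeq fun n => (eq_prod_mul_inverse_of_recurrence hq
    (B := fun n => ∑ s ∈ range (n + 1), a s * baileyCoeff q n (2 * s)) ?_ (fun n => ?_) n).symm
  · simp [ha, baileyCoeff]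
  · have hlast : ∑ s ∈ range (n + 1), a s * baileyCoeff q n (2 * s)
        = ∑ s ∈ range (n + 2), a s * baileyCoeff q n (2 * s) := by
      rw [sum_range_succ _ (n + 1), baileyCoeff_of_lt q (by omega), mul_zero, add_zero]
    rw [hlast, mul_sum, mul_sum, ← sub_eq_zero, ← sum_sub_distrib, ← h n]
    exact sum_congr rfl fun s _ => by ring

/-- Slater's pair C(5). -/
theorem isBaileyPair_evenSeq_unitAlpha :
    IsBaileyPair q (evenSeq (unitAlpha (q ^ 2)))
      fun n => q ^ n.choose 2 * (qPochhammer q q n * qPochhammer q (q ^ 2) n)⁻¹ʳ := by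
  have h := IsBaileyPair.of_telescope hq (a := unitAlpha (q ^ 2)) (c := fun n => q ^ n) rfl
    fun n => by
      rw [sum_unitAlpha_sq_telescope hq, Nat.sub_eq_zero_of_le (by omega)]
      simp
  have hprod (n : ℕ) : ∏ i ∈ range n, q ^ i = q ^ n.choose 2 := by
    rw [prod_pow_eq_pow_sum, Finset.sum_range_id, Nat.choose_two_right]
  simpa only [hprod] using h

/-- Slater's pair C(1). -/
theorem isBaileyPair_evenSeq_mul_unitAlpha :
    IsBaileyPair q (evenSeq fun s => (q ^ 2) ^ s ^ 2 * unitAlpha (q ^ 2) s)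
      fun n => (qPochhammer q q n * qPochhammer q (q ^ 2) n)⁻¹ʳ := by
  have h := IsBaileyPair.of_telescope hq (c := fun _ => 1)
    (a := fun s => (q ^ 2) ^ s ^ 2 * unitAlpha (q ^ 2) s) (by simp [unitAlpha]) fun n => by
      simp only [one_mul]
      rw [sum_mul_unitAlpha_sq_telescope hq, Nat.sub_eq_zero_of_le (by omega)]
      simp
  simpa only [prod_const_one, one_mul] using h

end UnitPair

section LambertPair

variable {A : Type*} [CommRing A]

/-- The term `q ^ n / (1 - q ^ n) ^ 2` of the Lambert series for the sums of divisors. It vanishes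
at `n = 0`, where `Ring.inverse 0 = 0`. -/
noncomputable def lambertTerm (q : A) (n : ℕ) : A := q ^ n * ((1 - q ^ n) ^ 2)⁻¹ʳ

@[simp]
theorem lambertTerm_zero (q : A) : lambertTerm q 0 = 0 := by simp [lambertTerm]

theorem lambertTerm_pow (q : A) (m n : ℕ) : lambertTerm (q ^ m) n = lambertTerm q (m * n) := by
  simp only [lambertTerm, pow_mul]

/-- The sequence `α` of the Bailey pair obtained from the unit pair through the conjugate Bailey
pair `δ n = (q; q)_n ^ 2 * q ^ n / (1 - q ^ n) ^ 2`. -/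
noncomputable def lambertAlpha (q : A) (r : ℕ) : A := -(unitAlpha q r * lambertTerm q r)

variable {q : A} (hq : ∀ n, IsUnit (1 - q ^ (n + 1)))
include hq

theorem one_sub_sq_mul_lambertTerm (n : ℕ) :
    (1 - q ^ (n + 1)) ^ 2 * lambertTerm q (n + 1) = q ^ (n + 1) := by
  rw [lambertTerm, mul_left_comm, Ring.mul_inverse_cancel _ ((hq n).pow 2), mul_one]

theorem qPochhammer_sq_mul_lambertTerm_succ (n : ℕ) :
    qPochhammer q q (n + 1) ^ 2 * lambertTerm q (n + 1)
      = q ^ (n + 1) * qPochhammer q q n ^ 2 := by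
  rw [qPochhammer_self_succ]
  linear_combination qPochhammer q q n ^ 2 * one_sub_sq_mul_lambertTerm hq n

theorem sum_qPochhammer_sq_mul_lambertTerm_mul_baileyCoeff {r : ℕ} (hr : r ≠ 0) (N : ℕ) :
    ∑ n ∈ range (N + 1), qPochhammer q q n ^ 2 * lambertTerm q n * baileyCoeff q n r
      = lambertTerm q r * qPochhammer q q N ^ 2 * baileyCoeff q N r := by
  obtain ⟨r, rfl⟩ := Nat.exists_eq_add_one_of_ne_zero hr
  induction N with
  | zero => simp [baileyCoeff]
  | succ N ih =>
    rw [sum_range_succ, ih, qPochhammer_sq_mul_lambertTerm_succ hq, qPochhammer_self_succ,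
      baileyCoeff_eq_mul_baileyCoeff_succ_left hq N]
    rcases lt_or_ge N r with h | h
    · simp [baileyCoeff_of_lt q (show N + 1 < r + 1 by omega)]
    obtain ⟨m, rfl⟩ := Nat.exists_eq_add_of_le' h
    rw [show m + r + 1 - (r + 1) = m by omega]
    linear_combination - qPochhammer q q (m + r) ^ 2 * baileyCoeff q (m + r + 1) (r + 1) *
      q ^ m * one_sub_sq_mul_lambertTerm hq r

theorem qPochhammer_sq_mul_baileyCoeff_zero (n : ℕ) :
    qPochhammer q q n ^ 2 * baileyCoeff q n 0 = 1 := by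
  rw [baileyCoeff_zero_right, ← sq,
    Ring.mul_inverse_cancel _ ((isUnit_qPochhammer_self hq n).pow 2)]

theorem isBaileyPair_lambertAlpha :
    IsBaileyPair q (lambertAlpha q)
      fun n => (∑ k ∈ range (n + 1), lambertTerm q k) * (qPochhammer q q n ^ 2)⁻¹ʳ := by
  intro N
  have hunit : ∑ r ∈ range (N + 1), unitAlpha q r *
      ∑ n ∈ range (N + 1), qPochhammer q q n ^ 2 * lambertTerm q n * baileyCoeff q n r = 0 := by
    simp only [mul_sum]
    rw [sum_comm]
    refine sum_eq_zero fun n hn => ?_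
    simp only [mul_left_comm (unitAlpha q _), ← mul_sum,
      ← (isBaileyPair_unit hq).eq_sum_range (mem_range.1 hn)]
    split_ifs with h0 <;> simp [h0]
  have hzero : ∑ n ∈ range (N + 1), qPochhammer q q n ^ 2 * lambertTerm q n * baileyCoeff q n 0
      = ∑ n ∈ range (N + 1), lambertTerm q n :=
    sum_congr rfl fun n _ => by
      rw [mul_right_comm, qPochhammer_sq_mul_baileyCoeff_zero hq, one_mul]
  rw [eq_comm, Ring.eq_mul_inverse_iff_mul_eq _ _ _ ((isUnit_qPochhammer_self hq N).pow 2),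
    sum_mul, sum_range_succ']
  rw [sum_range_succ', hzero] at hunit
  simp only [sum_qPochhammer_sq_mul_lambertTerm_mul_baileyCoeff hq (Nat.succ_ne_zero _),
    unitAlpha, one_mul] at hunit
  simp only [lambertAlpha, lambertTerm_zero, mul_zero, neg_zero, zero_mul, add_zero]
  rw [eq_comm, ← sub_eq_zero, ← hunit, sub_eq_add_neg, add_comm, ← sum_neg_distrib]
  congr 1
  exact sum_congr rfl fun r _ => by rw [unitAlpha]; ring

end LambertPair

section Convergence

variable {R : Type*} [CommRing R]

open Filter Topology

theorem isUnit_one_sub {a : R⟦X⟧} (ha : X ∣ a) : IsUnit (1 - a) := by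
  rw [isUnit_iff_constantCoeff]
  simp [X_dvd_iff.1 ha]

theorem isUnit_one_sub_pow_succ {q : R⟦X⟧} (hq : X ∣ q) (n : ℕ) : IsUnit (1 - q ^ (n + 1)) :=
  isUnit_one_sub (hq.trans (dvd_pow_self q n.succ_ne_zero))

variable [TopologicalSpace R]

theorem summable_of_X_pow_dvd {ι : Type*} {f : ι → R⟦X⟧} {d : ι → ℕ}
    (hd : ∀ m, {i | d i ≤ m}.Finite) (h : ∀ i, X ^ d i ∣ f i) : Summable f := by
  rw [WithPiTopology.summable_iff_summable_coeff]
  refine fun m => summable_of_hasFiniteSupport ((hd m).subset fun i hi => ?_)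
  by_contra hlt
  exact hi (X_pow_dvd_iff.1 (h i) m (not_le.1 hlt))

theorem summable_of_X_pow_dvd_nat {f : ℕ → R⟦X⟧} (h : ∀ n, X ^ n ∣ f n) : Summable f :=
  summable_of_X_pow_dvd (d := id) Set.finite_Iic h

theorem tendsto_of_X_pow_dvd_sub {s : ℕ → R⟦X⟧} {a : R⟦X⟧} (h : ∀ n, X ^ n ∣ s n - a) :
    Tendsto s atTop (𝓝 a) := by
  rw [WithPiTopology.tendsto_iff_coeff_tendsto]
  refine fun m => tendsto_const_nhds.congr' ?_
  filter_upwards [eventually_gt_atTop m] with n hn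
  rw [eq_comm, ← sub_eq_zero, ← map_sub]
  exact X_pow_dvd_iff.1 (h n) m hn

theorem hasSum_of_X_pow_dvd_sum_sub [T2Space R] {f : ℕ → R⟦X⟧} {a : R⟦X⟧}
    (h : ∀ n, X ^ n ∣ ∑ i ∈ range n, f i - a) : HasSum f a := by
  have hf : Summable f := summable_of_X_pow_dvd_nat fun n => by
    have := dvd_sub ((pow_dvd_pow X n.le_succ).trans (h (n + 1))) (h n)
    rwa [sum_range_succ, sub_sub_sub_cancel_right, add_sub_cancel_left] at this
  exact hf.hasSum_iff_tendsto_nat.2 (tendsto_of_X_pow_dvd_sub h)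

theorem X_pow_dvd_of_tendsto [T2Space R] {s : ℕ → R⟦X⟧} {a : R⟦X⟧} {n : ℕ}
    (hs : Tendsto s atTop (𝓝 a)) (h : ∀ k, X ^ n ∣ s k) : X ^ n ∣ a := by
  simp only [X_pow_dvd_iff] at h ⊢
  intro m hm
  refine tendsto_nhds_unique (((WithPiTopology.continuous_coeff R m).tendsto a).comp hs) ?_
  simp [Function.comp_def, h _ m hm]

theorem X_pow_dvd_tsum [T2Space R] {f : ℕ → R⟦X⟧} {n : ℕ}
    (h : ∀ i, X ^ n ∣ f i) : X ^ n ∣ ∑' i, f i := by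
  by_cases hf : Summable f
  · exact X_pow_dvd_of_tendsto hf.hasSum.tendsto_sum_nat fun k => dvd_sum fun i _ => h i
  · rw [tsum_eq_zero_of_not_summable hf]
    exact dvd_zero _

end Convergence

section QPochhammerInf

open Filter Topology

variable {R : Type*} [CommRing R]

theorem X_pow_dvd_qPochhammer_sub_one {a : R⟦X⟧} {n : ℕ} (ha : X ^ n ∣ a) (q : R⟦X⟧) (k : ℕ) :
    X ^ n ∣ qPochhammer a q k - 1 := by
  induction k with
  | zero => simp
  | succ k ih =>
    rw [qPochhammer_succ, show qPochhammer a q k * (1 - a * q ^ k) - 1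
      = qPochhammer a q k - 1 - a * (qPochhammer a q k * q ^ k) by ring]
    exact dvd_sub ih (ha.mul_right _)

variable [TopologicalSpace R]

/-- The infinite `q`-shifted factorial `(a; q)_∞` of power series over an arbitrary coefficient
ring; over `ℚ` it is `qPochInf`. -/
noncomputable def qPochhammerInf (a q : R⟦X⟧) : R⟦X⟧ := ∏' k : ℕ, (1 - a * q ^ k)

variable {q : R⟦X⟧} (hq : X ∣ q)
include hq

theorem multipliable_qPochhammer (a : R⟦X⟧) : Multipliable fun k : ℕ => 1 - a * q ^ k := by
  simp only [sub_eq_add_neg]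
  apply WithPiTopology.multipliable_one_add_of_tendsto_order_atTop_nhds_top
  rw [ENat.tendsto_nhds_top_iff_natCast_lt]
  intro m
  filter_upwards [eventually_gt_atTop m] with k hk
  refine (Nat.cast_lt.2 hk).trans_le (nat_le_order _ _ fun i hi => ?_)
  exact X_pow_dvd_iff.1 (dvd_neg.2 ((pow_dvd_pow_of_dvd hq k).mul_left a)) i hi

theorem tendsto_qPochhammer (a : R⟦X⟧) :
    Tendsto (qPochhammer a q) atTop (𝓝 (qPochhammerInf a q)) :=
  (multipliable_qPochhammer hq a).hasProd.tendsto_prod_nat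

variable [IsTopologicalRing R] [T2Space R]

theorem qPochhammer_mul_qPochhammerInf (a : R⟦X⟧) (n : ℕ) :
    qPochhammer a q n * qPochhammerInf (a * q ^ n) q = qPochhammerInf a q := by
  refine tendsto_nhds_unique ((tendsto_qPochhammer hq (a * q ^ n)).const_mul (qPochhammer a q n)) ?_
  simp only [← qPochhammer_add]
  simpa only [add_comm n] using (tendsto_add_atTop_iff_nat n).2 (tendsto_qPochhammer hq a)

theorem qPochhammerInf_eq_mul_sq (a : R⟦X⟧) :
    qPochhammerInf a q = qPochhammerInf a (q ^ 2) * qPochhammerInf (a * q) (q ^ 2) := by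
  have hq2 : X ∣ q ^ 2 := hq.trans (dvd_pow_self q two_ne_zero)
  have h := tprod_even_mul_odd (f := fun k => 1 - a * q ^ k)
    (by simpa only [pow_mul] using multipliable_qPochhammer hq2 a)
    (by simpa only [pow_mul, pow_succ', mul_assoc] using multipliable_qPochhammer hq2 (a * q))
  simp only [qPochhammerInf, ← h, pow_mul, pow_succ', mul_assoc]

theorem X_pow_dvd_qPochhammerInf_sub_one {a : R⟦X⟧} {n : ℕ} (ha : X ^ n ∣ a) :
    X ^ n ∣ qPochhammerInf a q - 1 :=
  X_pow_dvd_of_tendsto ((tendsto_qPochhammer hq a).sub_const 1) fun k =>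
    X_pow_dvd_qPochhammer_sub_one ha q k

theorem isUnit_qPochhammerInf {a : R⟦X⟧} (ha : X ∣ a) : IsUnit (qPochhammerInf a q) := by
  have h := X_pow_dvd_qPochhammerInf_sub_one hq (n := 1) (by simpa using ha)
  rw [← sub_sub_cancel 1 (qPochhammerInf a q)]
  exact isUnit_one_sub (by rwa [pow_one, dvd_sub_comm] at h)

end QPochhammerInf

section QBinomial

open Filter Topology

variable {R : Type*} [CommRing R] [TopologicalSpace R]

/-- The basic hypergeometric series `₁φ₀(a; q, t)`. -/
noncomputable def qBinomialSeries (a q t : R⟦X⟧) : R⟦X⟧ :=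
  ∑' n, qPochhammer a q n * (qPochhammer q q n)⁻¹ʳ * t ^ n

theorem summable_qBinomialSeries (a q : R⟦X⟧) {t : R⟦X⟧} (ht : X ∣ t) :
    Summable fun n => qPochhammer a q n * (qPochhammer q q n)⁻¹ʳ * t ^ n :=
  summable_of_X_pow_dvd_nat fun n => (pow_dvd_pow_of_dvd ht n).mul_left _

variable [IsTopologicalRing R] [T2Space R]

theorem X_pow_dvd_qBinomialSeries_sub_one (a q : R⟦X⟧) {t : R⟦X⟧} (ht : X ∣ t) {n : ℕ}
    (htn : X ^ n ∣ t) : X ^ n ∣ qBinomialSeries a q t - 1 := by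
  rw [qBinomialSeries, (summable_qBinomialSeries a q ht).tsum_eq_zero_add]
  simp only [qPochhammer_zero, Ring.inverse_one, pow_zero, mul_one, add_sub_cancel_left]
  exact X_pow_dvd_tsum fun i => (htn.trans (dvd_pow_self t i.succ_ne_zero)).mul_left _

variable {q : R⟦X⟧} (hq : X ∣ q)
include hq

theorem one_sub_mul_qBinomialSeries (a : R⟦X⟧) {t : R⟦X⟧} (ht : X ∣ t) :
    (1 - t) * qBinomialSeries a q t = (1 - a * t) * qBinomialSeries a q (t * q) := by
  have hsum := summable_qBinomialSeries a q ht
  have hsum' := summable_qBinomialSeries a q (ht.mul_right q)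
  have hrec (n : ℕ) : qPochhammer a q (n + 1) * (qPochhammer q q (n + 1))⁻¹ʳ * (1 - q ^ (n + 1))
      = qPochhammer a q n * (qPochhammer q q n)⁻¹ʳ * (1 - a * q ^ n) := by
    rw [← mul_inverse_mul_cancel_left (isUnit_one_sub_pow_succ hq n) (qPochhammer q q n),
      mul_comm (1 - q ^ (n + 1)) (qPochhammer q q n), ← qPochhammer_self_succ, qPochhammer_succ]
    ring
  have hdiff : qBinomialSeries a q t - qBinomialSeries a q (t * q)
      = t * qBinomialSeries a q t - a * t * qBinomialSeries a q (t * q) := by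
    rw [qBinomialSeries, qBinomialSeries, ← hsum.tsum_sub hsum', ← hsum.tsum_mul_left,
      ← hsum'.tsum_mul_left, ← (hsum.mul_left t).tsum_sub (hsum'.mul_left (a * t)),
      (hsum.sub hsum').tsum_eq_zero_add]
    simp only [pow_zero, sub_self, zero_add]
    exact tsum_congr fun n => by linear_combination t ^ (n + 1) * hrec n
  linear_combination hdiff

theorem qPochhammer_mul_qBinomialSeries (a : R⟦X⟧) {t : R⟦X⟧} (ht : X ∣ t) (n : ℕ) :
    qPochhammer t q n * qBinomialSeries a q t
      = qPochhammer (a * t) q n * qBinomialSeries a q (t * q ^ n) := by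
  induction n with
  | zero => simp
  | succ n ih =>
    rw [qPochhammer_succ, qPochhammer_succ, mul_right_comm, ih, pow_succ, ← mul_assoc t]
    linear_combination qPochhammer (a * t) q n *
      one_sub_mul_qBinomialSeries hq a (ht.mul_right (q ^ n))

theorem qBinomialSeries_eq (a : R⟦X⟧) {t : R⟦X⟧} (ht : X ∣ t) :
    qBinomialSeries a q t = qPochhammerInf (a * t) q * (qPochhammerInf t q)⁻¹ʳ := by
  rw [Ring.eq_mul_inverse_iff_mul_eq _ _ _ (isUnit_qPochhammerInf hq ht), mul_comm]
  have hlim : Tendsto (fun n => qBinomialSeries a q (t * q ^ n)) atTop (𝓝 1) :=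
    tendsto_of_X_pow_dvd_sub fun n =>
      X_pow_dvd_qBinomialSeries_sub_one a q (ht.mul_right _) ((pow_dvd_pow_of_dvd hq n).mul_left t)
  have h := (tendsto_qPochhammer hq (a * t)).mul hlim
  simp only [← qPochhammer_mul_qBinomialSeries hq a ht, mul_one] at h
  exact tendsto_nhds_unique ((tendsto_qPochhammer hq t).mul_const _) h

theorem hasSum_qBinomial (a : R⟦X⟧) {t : R⟦X⟧} (ht : X ∣ t) :
    HasSum (fun n => qPochhammer a q n * (qPochhammer q q n)⁻¹ʳ * t ^ n)
      (qPochhammerInf (a * t) q * (qPochhammerInf t q)⁻¹ʳ) := by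
  rw [← qBinomialSeries_eq hq a ht]
  exact (summable_qBinomialSeries a q ht).hasSum

theorem hasSum_inverse_qPochhammer_self_mul_pow {t : R⟦X⟧} (ht : X ∣ t) :
    HasSum (fun n => (qPochhammer q q n)⁻¹ʳ * t ^ n) (qPochhammerInf t q)⁻¹ʳ := by
  simpa [qPochhammer, qPochhammerInf] using hasSum_qBinomial hq 0 ht

end QBinomial

section RogersFine

open Filter Topology

variable {R : Type*} [CommRing R]

theorem isUnit_qPochhammer_of_X_dvd {a : R⟦X⟧} (ha : X ∣ a) (q : R⟦X⟧) (n : ℕ) :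
    IsUnit (qPochhammer a q n) :=
  isUnit_qPochhammer fun _ _ => isUnit_one_sub (ha.mul_right _)

theorem inverse_qPochhammer_eq_mul {a : R⟦X⟧} (ha : X ∣ a) (q : R⟦X⟧) (n : ℕ) :
    (qPochhammer a q n)⁻¹ʳ = (1 - a * q ^ n) * (qPochhammer a q (n + 1))⁻¹ʳ := by
  rw [qPochhammer_succ, mul_comm (qPochhammer a q n),
    mul_inverse_mul_cancel_left (isUnit_one_sub (ha.mul_right _))]

variable [TopologicalSpace R]

/-- The case of the Rogers–Fine function `∑ (α)_n / (β)_n t ^ n` with `α = 0`, normalised as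
`1 + ∑ (y b) (y q) ^ n / (b)_{n + 1}`. -/
noncomputable def rogersFineSeries (q b y : R⟦X⟧) : R⟦X⟧ :=
  1 + ∑' n, y * b * (y * q) ^ n * (qPochhammer b q (n + 1))⁻¹ʳ

theorem summable_rogersFineSeries {q : R⟦X⟧} (hq : X ∣ q) (b y : R⟦X⟧) :
    Summable fun n => y * b * (y * q) ^ n * (qPochhammer b q (n + 1))⁻¹ʳ :=
  summable_of_X_pow_dvd_nat fun n =>
    ((pow_dvd_pow_of_dvd (hq.mul_left y) n).mul_left _).mul_right _

theorem summable_pow_mul_inverse_qPochhammer (b q : R⟦X⟧) {t : R⟦X⟧} (ht : X ∣ t) :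
    Summable fun n => t ^ n * (qPochhammer b q n)⁻¹ʳ :=
  summable_of_X_pow_dvd_nat fun n => (pow_dvd_pow_of_dvd ht n).mul_right _

variable [IsTopologicalRing R] [T2Space R]

theorem one_sub_mul_tsum_pow_mul_inverse_qPochhammer (q : R⟦X⟧) {b t : R⟦X⟧} (hb : X ∣ b)
    (ht : X ∣ t) :
    (1 - t) * ∑' n, t ^ n * (qPochhammer b q n)⁻¹ʳ = rogersFineSeries q b t := by
  have hsum := summable_pow_mul_inverse_qPochhammer b q ht
  have hsum' := (summable_nat_add_iff 1).2 hsum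
  rw [one_sub_mul, ← hsum.tsum_mul_left, hsum.tsum_eq_zero_add, add_sub_assoc,
    ← hsum'.tsum_sub (hsum.mul_left t), rogersFineSeries]
  simp only [qPochhammer_zero, Ring.inverse_one, pow_zero, mul_one]
  exact congrArg (1 + ·) (tsum_congr fun n => by
    rw [inverse_qPochhammer_eq_mul hb q n]
    ring)

variable {q : R⟦X⟧} (hq : X ∣ q)
include hq

theorem rogersFineSeries_functional_eq {b : R⟦X⟧} (hb : X ∣ b) (y : R⟦X⟧) :
    (1 - b) * (1 - y * q) * (rogersFineSeries q b y - 1)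
      = y * b * rogersFineSeries q (b * q) (y * q) := by
  have hsum := summable_pow_mul_inverse_qPochhammer (b * q) q (hq.mul_left y)
  have hshift : (1 - b) * (rogersFineSeries q b y - 1)
      = y * b * ∑' n, (y * q) ^ n * (qPochhammer (b * q) q n)⁻¹ʳ := by
    rw [rogersFineSeries, add_sub_cancel_left, ← (summable_rogersFineSeries hq b y).tsum_mul_left,
      ← hsum.tsum_mul_left]
    refine tsum_congr fun n => ?_
    rw [← mul_inverse_mul_cancel_left (isUnit_one_sub hb) (qPochhammer (b * q) q n),
      ← qPochhammer_succ']
    ring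
  rw [← one_sub_mul_tsum_pow_mul_inverse_qPochhammer q (hb.mul_right q) (hq.mul_left y)]
  linear_combination (1 - y * q) * hshift

theorem rogersFineSeries_eq_sum_add {b : R⟦X⟧} (hb : X ∣ b) (y : R⟦X⟧) (K : ℕ) :
    rogersFineSeries q b y
      = ∑ k ∈ range K, (y * b) ^ k * q ^ (k * (k - 1)) *
          (qPochhammer b q k * qPochhammer (y * q) q k)⁻¹ʳ
        + (y * b) ^ K * q ^ (K * (K - 1)) * (qPochhammer b q K * qPochhammer (y * q) q K)⁻¹ʳ *
          rogersFineSeries q (b * q ^ K) (y * q ^ K) := by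
  induction K with
  | zero => simp
  | succ K ih =>
    have hinv : (qPochhammer b q K * qPochhammer (y * q) q K)⁻¹ʳ
        = (1 - b * q ^ K) * (1 - y * q * q ^ K) *
          (qPochhammer b q (K + 1) * qPochhammer (y * q) q (K + 1))⁻¹ʳ := by
      rw [qPochhammer_succ, qPochhammer_succ, mul_mul_mul_comm,
        mul_comm (qPochhammer b q K * _), mul_inverse_mul_cancel_left]
      exact (isUnit_one_sub (hb.mul_right _)).mul (isUnit_one_sub ((hq.mul_left y).mul_right _))
    have hexp : q ^ ((K + 1) * (K + 1 - 1)) = q ^ (K * (K - 1)) * (q ^ K) ^ 2 := by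
      rw [← pow_mul, ← pow_add]
      rcases K with _ | K
      · simp
      · rw [Nat.add_sub_cancel, Nat.add_sub_cancel]
        ring
    have hfun := rogersFineSeries_functional_eq hq (hb.mul_right (q ^ K)) (y * q ^ K)
    rw [ih, sum_range_succ, add_assoc, hinv, hexp, pow_succ q K, ← mul_assoc b, ← mul_assoc y]
    linear_combination (y * b) ^ K * q ^ (K * (K - 1)) *
      (qPochhammer b q (K + 1) * qPochhammer (y * q) q (K + 1))⁻¹ʳ * hfun

theorem hasSum_rogersFine {b : R⟦X⟧} (hb : X ∣ b) (y : R⟦X⟧) :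
    HasSum (fun k => (y * b) ^ k * q ^ (k * (k - 1)) *
      (qPochhammer b q k * qPochhammer (y * q) q k)⁻¹ʳ) (rogersFineSeries q b y) := by
  refine hasSum_of_X_pow_dvd_sum_sub fun K => ?_
  rw [rogersFineSeries_eq_sum_add hq hb y K, sub_add_cancel_left, dvd_neg]
  exact ((pow_dvd_pow_of_dvd (hb.mul_left y) K).mul_right _ |>.mul_right _).mul_right _

theorem rogersFineSeries_one {b : R⟦X⟧} (hb : X ∣ b) :
    rogersFineSeries q b 1 = (qPochhammerInf b q)⁻¹ʳ := by
  have hsum (N : ℕ) : ∑ n ∈ range N, b * q ^ n * (qPochhammer b q (n + 1))⁻¹ʳ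
      = (qPochhammer b q N)⁻¹ʳ - 1 := by
    have htel := sum_range_sub (fun n => (qPochhammer b q n)⁻¹ʳ) N
    rw [qPochhammer_zero, Ring.inverse_one] at htel
    rw [← htel]
    refine sum_congr rfl fun n _ => ?_
    rw [inverse_qPochhammer_eq_mul hb q n]
    ring
  have hinf (N : ℕ) : (qPochhammer b q N)⁻¹ʳ
      = qPochhammerInf (b * q ^ N) q * (qPochhammerInf b q)⁻¹ʳ := by
    rw [← qPochhammer_mul_qPochhammerInf hq b N, mul_comm (qPochhammer b q N),
      mul_inverse_mul_cancel_left (isUnit_qPochhammerInf hq (hb.mul_right _))]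
  have h : HasSum (fun n => b * q ^ n * (qPochhammer b q (n + 1))⁻¹ʳ)
      ((qPochhammerInf b q)⁻¹ʳ - 1) := by
    refine hasSum_of_X_pow_dvd_sum_sub fun N => ?_
    rw [hsum, hinf, sub_sub_sub_cancel_right, ← sub_one_mul]
    exact (X_pow_dvd_qPochhammerInf_sub_one hq
      ((pow_dvd_pow_of_dvd hq N).mul_left b)).mul_right _
  simp only [rogersFineSeries, one_mul, h.tsum_eq, add_sub_cancel]

theorem hasSum_cauchy {b : R⟦X⟧} (hb : X ∣ b) :
    HasSum (fun k => b ^ k * q ^ (k * (k - 1)) * (qPochhammer b q k * qPochhammer q q k)⁻¹ʳ)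
      (qPochhammerInf b q)⁻¹ʳ := by
  simpa only [one_mul, rogersFineSeries_one hq hb] using hasSum_rogersFine hq hb 1

end RogersFine

section BaileyTransform

variable {R : Type*} [CommRing R]

theorem X_pow_dvd_lambertTerm {q : R⟦X⟧} (hq : X ∣ q) (n : ℕ) : X ^ n ∣ lambertTerm q n :=
  (pow_dvd_pow_of_dvd hq n).mul_right _

theorem X_pow_dvd_qPochhammer_sq_mul_baileyCoeff_sub_one {q : R⟦X⟧} (hq : X ∣ q) (m r : ℕ) :
    X ^ (m + 1) ∣ qPochhammer q q (m + r) ^ 2 * baileyCoeff q (m + r) r - 1 := by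
  have hunit := isUnit_qPochhammer_of_X_dvd hq q
  set A := qPochhammer (q * q ^ m) q r
  set B := qPochhammer (q * q ^ (m + r)) q r with hB
  have hdvd (k : ℕ) (hk : m ≤ k) : X ^ (m + 1) ∣ qPochhammer (q * q ^ k) q r - 1 := by
    refine X_pow_dvd_qPochhammer_sub_one ?_ q r
    rw [← pow_succ']
    exact (pow_dvd_pow X (by omega)).trans (pow_dvd_pow_of_dvd hq (k + 1))
  have hBunit : IsUnit B := isUnit_qPochhammer_of_X_dvd (hq.mul_right _) q r
  have hratio : qPochhammer q q (m + r) ^ 2 * baileyCoeff q (m + r) r * B = A := by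
    have hcancel := Ring.mul_inverse_cancel _
      ((hunit m).mul ((hunit (m + r)).mul hBunit))
    rw [baileyCoeff_add_right, qPochhammer_add q q (m + r), ← hB]
    linear_combination A * hcancel + qPochhammer q q (m + r) * B *
      (qPochhammer q q m * (qPochhammer q q (m + r) * B))⁻¹ʳ * qPochhammer_add q q m r
  rw [← hBunit.dvd_mul_right, sub_one_mul, hratio, ← sub_sub_sub_cancel_right A B 1]
  exact dvd_sub (hdvd m le_rfl) (hdvd _ (Nat.le_add_right m r))

variable [TopologicalSpace R] [T2Space R]

theorem tsum_qPochhammer_sq_mul_lambertTerm_mul_baileyCoeff {q : R⟦X⟧} (hq : X ∣ q) {r : ℕ}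
    (hr : r ≠ 0) :
    ∑' n, qPochhammer q q n ^ 2 * lambertTerm q n * baileyCoeff q n r = lambertTerm q r := by
  refine (hasSum_of_X_pow_dvd_sum_sub fun N => ?_).tsum_eq
  rcases N with _ | N
  · simp
  rw [sum_qPochhammer_sq_mul_lambertTerm_mul_baileyCoeff (isUnit_one_sub_pow_succ hq) hr,
    mul_assoc, ← mul_sub_one]
  rcases lt_or_ge N r with h | h
  · exact ((pow_dvd_pow X h).trans (X_pow_dvd_lambertTerm hq r)).mul_right _
  · obtain ⟨m, rfl⟩ := Nat.exists_eq_add_of_le' h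
    rw [show m + r + 1 = r + (m + 1) by ring, pow_add]
    exact mul_dvd_mul (X_pow_dvd_lambertTerm hq r)
      (X_pow_dvd_qPochhammer_sq_mul_baileyCoeff_sub_one hq m r)

variable [IsTopologicalRing R]

theorem IsBaileyPair.tsum_mul_eq {q : R⟦X⟧} {α β δ : ℕ → R⟦X⟧} (h : IsBaileyPair q α β)
    (hδ : ∀ n, X ^ n ∣ δ n) :
    ∑' n, δ n * β n = ∑' r, α r * ∑' n, δ n * baileyCoeff q n r := by
  have hrow (r : ℕ) : Summable fun n => δ n * baileyCoeff q n r :=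
    summable_of_X_pow_dvd_nat fun n => (hδ n).mul_right _
  have hfamily : Summable (Function.uncurry fun n r => α r * (δ n * baileyCoeff q n r)) := by
    refine summable_of_X_pow_dvd (d := fun p => max p.1 p.2)
      (fun m => (Set.finite_Iic (m, m)).subset fun p hp => ?_) fun ⟨n, r⟩ => ?_
    · exact Prod.mk_le_mk.2 (max_le_iff.1 hp)
    · rcases lt_or_ge n r with hnr | hnr
      · simp [baileyCoeff_of_lt q hnr]
      · simpa only [Function.uncurry, max_eq_left hnr] using ((hδ n).mul_right _).mul_left _
  have hβ (n : ℕ) : δ n * β n = ∑' r, α r * (δ n * baileyCoeff q n r) := by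
    rw [tsum_eq_sum (s := range (n + 1)) fun r hr => ?_, h n, mul_sum]
    · exact sum_congr rfl fun r _ => mul_left_comm _ _ _
    · rw [baileyCoeff_of_lt q (by simpa using hr), mul_zero, mul_zero]
  simp only [hβ, ← (hrow _).tsum_mul_left]
  exact (hfamily.tsum_comm' (fun n => summable_of_ne_finset_zero (s := range (n + 1))
    fun r hr => by rw [baileyCoeff_of_lt q (by simpa using hr), mul_zero, mul_zero])
    fun r => (hrow r).mul_left _).symm

variable {q : R⟦X⟧} (hq : X ∣ q)
include hq

theorem tsum_pow_sq_mul_baileyCoeff (r : ℕ) :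
    ∑' n, q ^ n ^ 2 * baileyCoeff q n r = q ^ r ^ 2 * (qPochhammerInf q q)⁻¹ʳ := by
  have hsum : Summable fun n => q ^ n ^ 2 * baileyCoeff q n r :=
    summable_of_X_pow_dvd_nat fun n => ((pow_dvd_pow_of_dvd hq n).trans
      (pow_dvd_pow q (Nat.le_self_pow two_ne_zero n))).mul_right _
  have hunit := isUnit_qPochhammer_of_X_dvd hq q
  have hterm (m : ℕ) : q ^ (m + r) ^ 2 * baileyCoeff q (m + r) r
      = q ^ r ^ 2 * (qPochhammer q q (2 * r))⁻¹ʳ *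
        ((q * q ^ (2 * r)) ^ m * q ^ (m * (m - 1)) *
          (qPochhammer (q * q ^ (2 * r)) q m * qPochhammer q q m)⁻¹ʳ) := by
    have hexp : q ^ (m + r) ^ 2 = q ^ r ^ 2 * (q * q ^ (2 * r)) ^ m * q ^ (m * (m - 1)) := by
      rcases m with _ | m
      · simp
      · rw [Nat.add_sub_cancel]; ring
    rw [baileyCoeff_add_right, show m + r + r = 2 * r + m by ring, qPochhammer_add, hexp,
      mul_left_comm, Ring.inverse_mul (.inl (hunit _)), mul_comm (qPochhammer q q m)]
    ring
  rw [← hsum.sum_add_tsum_nat_add r, sum_eq_zero fun n hn => by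
    rw [baileyCoeff_of_lt q (mem_range.1 hn), mul_zero], zero_add]
  have hcauchy := hasSum_cauchy hq (hq.mul_right (q ^ (2 * r)))
  simp only [hterm]
  rw [hcauchy.summable.tsum_mul_left, hcauchy.tsum_eq, mul_assoc, mul_comm (_⁻¹ʳ),
    ← Ring.inverse_mul (.inl (hunit _)), qPochhammer_mul_qPochhammerInf hq]

theorem IsBaileyPair.tsum_pow_sq_mul {α β : ℕ → R⟦X⟧} (h : IsBaileyPair q α β) :
    ∑' n, q ^ n ^ 2 * β n = (qPochhammerInf q q)⁻¹ʳ * ∑' r, q ^ r ^ 2 * α r := by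
  have hdvd (n : ℕ) : X ^ n ∣ q ^ n ^ 2 :=
    (pow_dvd_pow_of_dvd hq n).trans (pow_dvd_pow q (Nat.le_self_pow two_ne_zero n))
  have hsum : Summable fun r => q ^ r ^ 2 * α r :=
    summable_of_X_pow_dvd_nat fun r => (hdvd r).mul_right _
  rw [h.tsum_mul_eq hdvd, ← hsum.tsum_mul_left]
  exact tsum_congr fun r => by rw [tsum_pow_sq_mul_baileyCoeff hq]; ring

theorem IsBaileyPair.tsum_qPochhammer_sq_mul_lambertTerm_mul {α β : ℕ → R⟦X⟧}
    (h : IsBaileyPair q α β) :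
    ∑' n, qPochhammer q q n ^ 2 * lambertTerm q n * β n
      = α 0 * ∑' n, lambertTerm q n + ∑' r, α r * lambertTerm q r := by
  have hγ (r : ℕ) : α r * ∑' n, qPochhammer q q n ^ 2 * lambertTerm q n * baileyCoeff q n r
      = (if r = 0 then α 0 * ∑' n, lambertTerm q n else 0) + α r * lambertTerm q r := by
    split_ifs with hr
    · subst hr
      rw [lambertTerm_zero, mul_zero, add_zero]
      simp only [mul_right_comm _ (lambertTerm q _),
        qPochhammer_sq_mul_baileyCoeff_zero (isUnit_one_sub_pow_succ hq), one_mul]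
    · rw [tsum_qPochhammer_sq_mul_lambertTerm_mul_baileyCoeff hq hr, zero_add]
  rw [h.tsum_mul_eq fun n => (X_pow_dvd_lambertTerm hq n).mul_left _, tsum_congr hγ,
    Summable.tsum_add, tsum_ite_eq]
  · exact (hasSum_ite_eq 0 _).summable
  · exact summable_of_X_pow_dvd_nat fun r => (X_pow_dvd_lambertTerm hq r).mul_left _

theorem tsum_unitAlpha_mul_lambertTerm :
    ∑' r, unitAlpha q r * lambertTerm q r = -∑' n, lambertTerm q n := by
  have h := (isBaileyPair_unit (isUnit_one_sub_pow_succ hq)).tsum_qPochhammer_sq_mul_lambertTerm_mul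
    hq
  have hβ (n : ℕ) : qPochhammer q q n ^ 2 * lambertTerm q n * (if n = 0 then 1 else 0) = 0 := by
    split_ifs with hn <;> simp [hn]
  rw [tsum_congr hβ, tsum_zero, unitAlpha, one_mul] at h
  linear_combination -h

end BaileyTransform

section Lambert

variable {R : Type*} [CommRing R] [TopologicalSpace R] [T2Space R]

theorem hasSum_succ_mul_pow {x : R⟦X⟧} (hx : X ∣ x) :
    HasSum (fun n : ℕ => (n + 1 : R⟦X⟧) * x ^ n) ((1 - x) ^ 2)⁻¹ʳ := by
  have hunit := (isUnit_one_sub hx).pow 2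
  refine hasSum_of_X_pow_dvd_sum_sub fun N => ?_
  have hpartial : (1 - x) ^ 2 * ∑ n ∈ range N, (n + 1 : R⟦X⟧) * x ^ n
      = 1 - x ^ N * (1 + N * (1 - x)) := by
    induction N with
    | zero => simp
    | succ N ih =>
      rw [sum_range_succ, mul_add, ih]
      push_cast
      ring
  rw [← hunit.dvd_mul_left, mul_sub, Ring.mul_inverse_cancel _ hunit, hpartial,
    sub_sub_cancel_left, dvd_neg]
  exact (pow_dvd_pow_of_dvd hx N).mul_right _

variable [IsTopologicalRing R]

theorem hasSum_pow_eq_inverse_one_sub {x : R⟦X⟧} (hx : X ∣ x) :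
    HasSum (fun n => x ^ n) (1 - x)⁻¹ʳ := by
  have h := WithPiTopology.summable_pow_of_constantCoeff_eq_zero (X_dvd_iff.1 hx)
  have hinv : ∑' n, x ^ n = (1 - x)⁻¹ʳ :=
    (Ring.eq_mul_inverse_iff_mul_eq _ 1 _ (isUnit_one_sub hx)).2 h.tsum_pow_mul_one_sub
      |>.trans (one_mul _)
  exact hinv ▸ h.hasSum

theorem hasSum_mul_pow_mul_inverse_one_sub {q : R⟦X⟧} (hq : X ∣ q) :
    HasSum (fun n : ℕ => (n : R⟦X⟧) * q ^ n * (1 - q ^ n)⁻¹ʳ) (∑' n, lambertTerm q n) := by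
  have hdvd (n : ℕ) : X ∣ q ^ (n + 1) := hq.trans (dvd_pow_self q n.succ_ne_zero)
  have hmax (n m : ℕ) : X ^ max n m ∣ (n + 1 : R⟦X⟧) * q ^ ((n + 1) * (m + 1)) := by
    refine ((pow_dvd_pow X (max_le ?_ ?_)).trans (pow_dvd_pow_of_dvd hq _)).mul_left _ <;>
      nlinarith
  have hfamily : Summable (Function.uncurry fun n m : ℕ =>
      (n + 1 : R⟦X⟧) * q ^ ((n + 1) * (m + 1))) :=
    summable_of_X_pow_dvd (d := fun p => max p.1 p.2)
      (fun m => (Set.finite_Iic (m, m)).subset fun p hp => Prod.mk_le_mk.2 (max_le_iff.1 hp))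
      fun p => hmax p.1 p.2
  have hrow (n : ℕ) : ∑' m : ℕ, (n + 1 : R⟦X⟧) * q ^ ((n + 1) * (m + 1))
      = ((n + 1 : ℕ) : R⟦X⟧) * q ^ (n + 1) * (1 - q ^ (n + 1))⁻¹ʳ := by
    rw [← ((hasSum_pow_eq_inverse_one_sub (hdvd n)).mul_left
      (((n + 1 : ℕ) : R⟦X⟧) * q ^ (n + 1))).tsum_eq]
    refine tsum_congr fun m => ?_
    push_cast
    ring
  have hcol (m : ℕ) : ∑' n : ℕ, (n + 1 : R⟦X⟧) * q ^ ((n + 1) * (m + 1))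
      = lambertTerm q (m + 1) := by
    rw [lambertTerm, ← ((hasSum_succ_mul_pow (hdvd m)).mul_left (q ^ (m + 1))).tsum_eq]
    exact tsum_congr fun n => by ring
  have hcomm := hfamily.tsum_comm'
    (fun n => summable_of_X_pow_dvd_nat fun m =>
      (pow_dvd_pow X (le_max_right n m)).trans (hmax n m))
    fun m => summable_of_X_pow_dvd_nat fun n => (pow_dvd_pow X (le_max_left n m)).trans (hmax n m)
  simp only [hrow, hcol] at hcomm
  have hsum : Summable fun n : ℕ => (n : R⟦X⟧) * q ^ n * (1 - q ^ n)⁻¹ʳ :=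
    summable_of_X_pow_dvd_nat fun n => ((pow_dvd_pow_of_dvd hq n).mul_left _).mul_right _
  rw [(summable_of_X_pow_dvd_nat (X_pow_dvd_lambertTerm hq)).tsum_eq_zero_add, hcomm,
    hsum.hasSum_iff, hsum.tsum_eq_zero_add]
  simp

end Lambert

section Partitions

variable {R : Type*} [CommRing R]

/-- The generating function `∑ w(p) X ^ |p|` of all partitions `p`, where the weight `w` is a
function of the multiset of parts. -/
noncomputable def partitionSeries (w : Multiset ℕ → R) : R⟦X⟧ :=
  PowerSeries.mk fun n => ∑ p : n.Partition, w p.parts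

theorem coeff_partitionSeries (w : Multiset ℕ → R) (n : ℕ) :
    coeff n (partitionSeries w) = ∑ p : n.Partition, w p.parts :=
  coeff_mk _ _

theorem partitionSeries_sub (v w : Multiset ℕ → R) :
    partitionSeries (fun s => v s - w s) = partitionSeries v - partitionSeries w := by
  ext n
  simp only [coeff_partitionSeries, map_sub, sum_sub_distrib]

theorem partitionSeries_const_mul (c : R) (w : Multiset ℕ → R) :
    partitionSeries (fun s => c * w s) = C c * partitionSeries w := by
  ext n
  simp only [coeff_partitionSeries, coeff_C_mul, mul_sum]

theorem partitionSeries_prod_count (f : ℕ → ℕ → R) :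
    partitionSeries (fun s => s.toFinsupp.prod f) = Nat.Partition.genFun f :=
  rfl

theorem prod_map_ite_sup_le (b : ℕ → R) (L : ℕ) (s : Multiset ℕ) :
    (s.map fun i => if i ≤ L then b i else 0).prod = if s.sup ≤ L then (s.map b).prod else 0 := by
  split_ifs with h
  · exact congrArg _ (Multiset.map_congr rfl fun i hi => if_pos ((Multiset.le_sup hi).trans h))
  · simp only [Multiset.sup_le, not_forall] at h
    obtain ⟨i, hi, hL⟩ := h
    exact Multiset.prod_eq_zero (Multiset.mem_map.2 ⟨i, hi, if_neg hL⟩)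

theorem prod_inverse_one_sub_C_mul_X_pow (c : R) (N : ℕ) :
    ∏ i ∈ range N, (1 - C c * X ^ (i + 1))⁻¹ʳ = (qPochhammer (C c * X) X N)⁻¹ʳ := by
  simp only [qPochhammer, ← MonoidWithZero.coe_inverse, map_prod, pow_succ', mul_assoc]

theorem prod_map_ite_eq_one (s : Multiset ℕ) :
    (s.map fun i => if i = 1 then (0 : R) else 1).prod = if s.count 1 = 0 then 1 else 0 := by
  split_ifs with h
  · refine Multiset.prod_eq_one fun x hx => ?_
    obtain ⟨i, hi, rfl⟩ := Multiset.mem_map.1 hx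
    exact if_neg (ne_of_mem_of_not_mem hi (Multiset.count_eq_zero.1 h))
  · exact Multiset.prod_eq_zero
      (Multiset.mem_map.2 ⟨1, Multiset.count_ne_zero.1 h, if_pos rfl⟩)

theorem prod_map_ite_le (y : R) (m : ℕ) (s : Multiset ℕ) :
    (s.map fun i => if i ≤ m then 1 else y).prod = y ^ (s.filter (m < ·)).card := by
  induction s using Multiset.induction_on with
  | empty => simp only [Multiset.map_zero, Multiset.prod_zero, Multiset.filter_zero,
      Multiset.card_zero, pow_zero]
  | cons i s ih =>
    rw [Multiset.map_cons, Multiset.prod_cons, ih]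
    rcases le_or_gt i m with h | h
    · rw [if_pos h, one_mul, Multiset.filter_cons_of_neg _ h.not_gt]
    · rw [if_neg h.not_ge, Multiset.filter_cons_of_pos _ h, Multiset.card_cons, pow_succ']

theorem toFinsupp_prod_pow (b : ℕ → R) (s : Multiset ℕ) :
    s.toFinsupp.prod (fun i c => b i ^ c) = (s.map b).prod := by
  rw [Finset.prod_multiset_map_count, Finsupp.prod, Multiset.toFinsupp_support]
  simp only [Multiset.toFinsupp_apply]

theorem toFinsupp_prod_ite_one_mul_pow (a b : ℕ → R) (s : Multiset ℕ) :
    s.toFinsupp.prod (fun i c => (if i = 1 then a c else 1) * b i ^ c)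
      = (if s.count 1 = 0 then 1 else a (s.count 1)) * (s.map b).prod := by
  rw [Finsupp.prod_mul, toFinsupp_prod_pow, Finsupp.prod, Multiset.toFinsupp_support,
    prod_ite_eq']
  simp only [Multiset.mem_toFinset, Multiset.count_eq_zero, Multiset.toFinsupp_apply, ite_not]

variable [TopologicalSpace R]

theorem hasSum_partitionSeries_fiber (g : Multiset ℕ → ℕ) (w : Multiset ℕ → R) [ContinuousAdd R] :
    HasSum (fun m => partitionSeries fun s => if g s = m then w s else 0) (partitionSeries w) := by
  refine (WithPiTopology.hasSum_iff_hasSum_coeff R).2 fun n => ?_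
  simp only [coeff_partitionSeries]
  exact hasSum_sum fun p _ => by simpa only [eq_comm] using hasSum_ite_eq (g p.parts) (w p.parts)

variable [IsTopologicalRing R] [T2Space R]

theorem one_add_tsum_pow_smul_X_pow (c : R) (i : ℕ) :
    1 + ∑' j, c ^ (j + 1) • (X : R⟦X⟧) ^ ((i + 1) * (j + 1)) = (1 - C c * X ^ (i + 1))⁻¹ʳ := by
  have h := hasSum_pow_eq_inverse_one_sub
    ((dvd_pow_self (X : R⟦X⟧) i.succ_ne_zero).mul_left (C c))
  rw [← h.tsum_eq, h.summable.tsum_eq_zero_add, pow_zero]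
  simp only [smul_eq_C_mul, mul_pow, map_pow, pow_mul]

theorem hasProd_partitionSeries (b : ℕ → R) :
    HasProd (fun i => (1 - C (b (i + 1)) * X ^ (i + 1))⁻¹ʳ)
      (partitionSeries fun s => (s.map b).prod) := by
  simpa only [one_add_tsum_pow_smul_X_pow, ← partitionSeries_prod_count, toFinsupp_prod_pow] using
    Nat.Partition.hasProd_genFun fun i c => b i ^ c

theorem partitionSeries_sup_le (b : ℕ → R) (L : ℕ) :
    partitionSeries (fun s => if s.sup ≤ L then (s.map b).prod else 0)
      = ∏ i ∈ range L, (1 - C (b (i + 1)) * X ^ (i + 1))⁻¹ʳ := by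
  have h := hasProd_partitionSeries fun i => if i ≤ L then b i else 0
  simp only [prod_map_ite_sup_le] at h
  refine (h.unique (hasProd_prod_of_ne_finset_one (s := range L) fun i hi => ?_)).trans
    (prod_congr rfl fun i hi => ?_)
  · rw [if_neg (by simpa using hi)]
    simp
  · rw [if_pos (by simpa [Nat.succ_le_iff] using hi)]

theorem partitionSeries_sup_eq_succ (b : ℕ → R) (L : ℕ) :
    partitionSeries (fun s => if s.sup = L + 1 then (s.map b).prod else 0)
      = C (b (L + 1)) * X ^ (L + 1) *
        ∏ i ∈ range (L + 1), (1 - C (b (i + 1)) * X ^ (i + 1))⁻¹ʳ := by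
  have hsplit (s : Multiset ℕ) : (if s.sup = L + 1 then (s.map b).prod else 0)
      = (if s.sup ≤ L + 1 then (s.map b).prod else 0)
        - if s.sup ≤ L then (s.map b).prod else 0 := by
    grind
  have hunit : IsUnit (1 - C (b (L + 1)) * X ^ (L + 1)) :=
    isUnit_one_sub ((dvd_pow_self X L.succ_ne_zero).mul_left _)
  simp only [hsplit, partitionSeries_sub, partitionSeries_sup_le, prod_range_succ]
  linear_combination (∏ i ∈ range L, (1 - C (b (i + 1)) * X ^ (i + 1))⁻¹ʳ) *
    Ring.mul_inverse_cancel _ hunit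

theorem hasSum_partitionSeries_pow_sup (y : R) (b : ℕ → R) :
    HasSum (fun L => C (y ^ (L + 1) * b (L + 1)) * X ^ (L + 1) *
        ∏ i ∈ range (L + 1), (1 - C (b (i + 1)) * X ^ (i + 1))⁻¹ʳ)
      (partitionSeries (fun s => y ^ s.sup * (s.map b).prod) - 1) := by
  have h := hasSum_partitionSeries_fiber Multiset.sup fun s => y ^ s.sup * (s.map b).prod
  have hfiber (L : ℕ) (s : Multiset ℕ) :
      (if s.sup = L then y ^ s.sup * (s.map b).prod else 0)
        = y ^ L * if s.sup = L then (s.map b).prod else 0 := by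
    split_ifs with hL
    · rw [hL]
    · rw [mul_zero]
  simp only [hfiber, partitionSeries_const_mul] at h
  have h0 := partitionSeries_sup_le b 0
  simp only [nonpos_iff_eq_zero, prod_range_zero] at h0
  have h' := (hasSum_nat_add_iff' 1).2 h
  simpa only [sum_range_one, partitionSeries_sup_eq_succ, h0, pow_zero, map_one, mul_one, map_mul,
    mul_assoc] using h'

theorem partitionSeries_pow_sup_mul_pow_card (y z : R) :
    partitionSeries (fun s => y ^ s.sup * z ^ s.card) = rogersFineSeries X (C z * X) (C y) := by
  have h := hasSum_partitionSeries_pow_sup y fun _ => z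
  simp only [Multiset.map_const', Multiset.prod_replicate, prod_inverse_one_sub_C_mul_X_pow] at h
  rw [rogersFineSeries, ← sub_eq_iff_eq_add', ← h.tsum_eq]
  refine tsum_congr fun L => ?_
  rw [map_mul, map_pow]
  ring

theorem partitionSeries_count_one_eq_zero_pow_sup (y : R) :
    partitionSeries (fun s => if s.count 1 = 0 then y ^ s.sup else 0)
      = (1 - X) * (qPochhammerInf (C y * X) X)⁻¹ʳ + X - C y * X := by
  have h := hasSum_partitionSeries_pow_sup y fun i => if i = 1 then 0 else 1
  have hEuler := (hasSum_inverse_qPochhammer_self_mul_pow (dvd_refl (X : R⟦X⟧))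
    (dvd_mul_left X (C y))).mul_left (1 - X)
  have hprod (L : ℕ) :
      ∏ i ∈ range (L + 1), (1 - C (if i + 1 = 1 then (0 : R) else 1) * X ^ (i + 1))⁻¹ʳ
        = (1 - X) * (qPochhammer X X (L + 1))⁻¹ʳ := by
    have hX := isUnit_one_sub (dvd_refl (X : R⟦X⟧))
    have h := prod_inverse_one_sub_C_mul_X_pow (1 : R) (L + 1)
    rw [map_one, one_mul, prod_range_succ', zero_add, pow_one, one_mul] at h
    rw [← h, mul_left_comm, Ring.mul_inverse_cancel _ hX, prod_range_succ']
    simp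
  have h₁ := (hasSum_nat_add_iff' 1).2 h
  have h₂ := (hasSum_nat_add_iff' 2).2 hEuler
  have hunit : (1 - X : R⟦X⟧) * (qPochhammer X X 1)⁻¹ʳ = 1 := by
    rw [qPochhammer_self_succ, qPochhammer_zero, one_mul, zero_add, pow_one,
      Ring.mul_inverse_cancel _ (isUnit_one_sub dvd_rfl)]
  have hterm (L : ℕ) : C (y ^ (L + 1 + 1) * if L + 1 + 1 = 1 then 0 else 1) * X ^ (L + 1 + 1) *
      ∏ i ∈ range (L + 1 + 1), (1 - C (if i + 1 = 1 then (0 : R) else 1) * X ^ (i + 1))⁻¹ʳ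
      = (1 - X) * ((qPochhammer X X (L + 2))⁻¹ʳ * (C y * X) ^ (L + 2)) := by
    rw [hprod, if_neg (by omega), mul_one, map_pow]
    ring
  have hweight (s : Multiset ℕ) : y ^ s.sup * (s.map fun i => if i = 1 then (0 : R) else 1).prod
      = if s.count 1 = 0 then y ^ s.sup else 0 := by
    rw [prod_map_ite_eq_one, mul_ite, mul_one, mul_zero]
  simp only [hterm, hweight] at h₁
  have hsum := h₁.unique h₂
  rw [sum_range_one, sum_range_succ, sum_range_one, zero_add, if_pos rfl, mul_zero, map_zero,
    zero_mul, zero_mul, sub_zero, pow_zero, mul_one, pow_one, qPochhammer_zero, Ring.inverse_one,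
    mul_one] at hsum
  linear_combination hsum - C y * X * hunit

theorem genFun_ite_one_mul_pow (a : ℕ → R) {b : ℕ → R} (hb : b 1 = 1) :
    Nat.Partition.genFun (fun i c => (if i = 1 then a c else 1) * b i ^ c)
      = (1 + ∑' j, a (j + 1) • X ^ (j + 1)) *
        ((1 - X) * partitionSeries fun s => (s.map b).prod) := by
  refine (Nat.Partition.hasProd_genFun _).unique ?_
  have h := (hasProd_ite_eq 0 ((1 + ∑' j, a (j + 1) • X ^ (j + 1)) * (1 - X : R⟦X⟧))).mul
    (hasProd_partitionSeries b)
  rw [← mul_assoc]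
  refine (congrArg (HasProd · _) (funext fun i => ?_)).mpr h
  rcases i with _ | i
  · simp only [zero_add, if_true, hb, one_pow, mul_one, one_mul, pow_one, map_one]
    rw [mul_assoc, Ring.mul_inverse_cancel _ (isUnit_one_sub dvd_rfl), mul_one]
  · rw [← one_add_tsum_pow_smul_X_pow]
    simp

theorem partitionSeries_count_one_eq {b : ℕ → R} (hb : b 1 = 1) {m : ℕ} (hm : m ≠ 0) :
    partitionSeries (fun s => if s.count 1 = m then (s.map b).prod else 0)
      = X ^ m * ((1 - X) * partitionSeries fun s => (s.map b).prod) := by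
  have h₀ := genFun_ite_one_mul_pow (fun _ => 0) hb
  have h₁ := genFun_ite_one_mul_pow (fun c => if c = m then 1 else 0) hb
  have htsum : ∑' j, (if j + 1 = m then (1 : R) else 0) • (X : R⟦X⟧) ^ (j + 1) = X ^ m := by
    obtain ⟨k, rfl⟩ := Nat.exists_eq_succ_of_ne_zero hm
    rw [tsum_eq_single k fun j hj => by simp [hj]]
    simp
  have hweight (s : Multiset ℕ) : (if s.count 1 = m then (s.map b).prod else 0)
      = (if s.count 1 = 0 then 1 else if s.count 1 = m then 1 else 0) * (s.map b).prod
        - (if s.count 1 = 0 then 1 else 0) * (s.map b).prod := by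
    grind
  simp only [← partitionSeries_prod_count, toFinsupp_prod_ite_one_mul_pow, zero_smul, tsum_zero,
    htsum] at h₀ h₁
  simp only [hweight, partitionSeries_sub, h₀, h₁]
  ring

theorem partitionSeries_pow_card_filter (y : R) (m : ℕ) :
    partitionSeries (fun s => y ^ (s.filter (m < ·)).card)
      = qPochhammer (C y * X) X m * (qPochhammer X X m)⁻¹ʳ * (qPochhammerInf (C y * X) X)⁻¹ʳ := by
  have h := (hasProd_partitionSeries fun i => if i ≤ m then 1 else y).mul
    (multipliable_qPochhammer (dvd_refl (X : R⟦X⟧)) (C y * X)).hasProd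
  simp only [prod_map_ite_le] at h
  have hunit := isUnit_qPochhammerInf (dvd_refl (X : R⟦X⟧)) (dvd_mul_left X (C y))
  rw [Ring.eq_mul_inverse_iff_mul_eq _ _ _ hunit]
  refine (h.unique (hasProd_prod_of_ne_finset_one (s := range m) fun i hi => ?_)).trans ?_
  · have hi : m < i + 1 := by simpa [Nat.lt_succ_iff] using hi
    rw [if_neg hi.not_ge, pow_succ', mul_assoc,
      Ring.inverse_mul_cancel _ (isUnit_one_sub ((dvd_mul_right _ _).mul_left _))]
  · have hprod : ∏ i ∈ range m, (1 - C (if i + 1 ≤ m then 1 else y) * X ^ (i + 1))⁻¹ʳ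
        = (qPochhammer X X m)⁻¹ʳ := by
      have h := prod_inverse_one_sub_C_mul_X_pow (1 : R) m
      rw [map_one, one_mul] at h
      refine (prod_congr rfl fun i hi => ?_).trans h
      rw [if_pos (Nat.succ_le_of_lt (mem_range.1 hi)), map_one, one_mul]
    rw [prod_mul_distrib, hprod, mul_comm, ← qPochhammer]

/-- The weight `y ^ a * z ^ b` of a partition with multiset of parts `s`, where `a` and `b` are the
two numbers whose difference `a - b` is the Andrews–Garvan crank. -/
def crankWeight (y z : R) (s : Multiset ℕ) : R :=
  if s.count 1 = 0 then y ^ s.sup else y ^ (s.filter (s.count 1 < ·)).card * z ^ s.count 1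

theorem partitionSeries_crankWeight (y z : R) :
    partitionSeries (crankWeight y z) = X - C y * X + (1 - X) *
      (qPochhammerInf (C (y * z) * X ^ 2) X *
        (qPochhammerInf (C y * X) X * qPochhammerInf (C z * X) X)⁻¹ʳ) := by
  have h := (hasSum_nat_add_iff' 1).2
    (hasSum_partitionSeries_fiber (Multiset.count 1) (crankWeight y z))
  have hbinomial := (hasSum_nat_add_iff' 1).2 ((hasSum_qBinomial (dvd_refl (X : R⟦X⟧)) (C y * X)
    (dvd_mul_left X (C z))).mul_left ((1 - X) * (qPochhammerInf (C y * X) X)⁻¹ʳ))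
  have hzero (s : Multiset ℕ) : (if s.count 1 = 0 then crankWeight y z s else 0)
      = if s.count 1 = 0 then y ^ s.sup else 0 := by
    grind [crankWeight]
  have hsucc (m : ℕ) (s : Multiset ℕ) : (if s.count 1 = m + 1 then crankWeight y z s else 0)
      = z ^ (m + 1) * if s.count 1 = m + 1 then
        (s.map fun i => if i ≤ m + 1 then 1 else y).prod else 0 := by
    rw [prod_map_ite_le, crankWeight]
    split_ifs with h₁ h₂
    · omega
    · rw [h₁, mul_comm]
    · rw [mul_zero]
  have hterm (m : ℕ) :
      partitionSeries (fun s => if s.count 1 = m + 1 then crankWeight y z s else 0)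
        = (1 - X) * (qPochhammerInf (C y * X) X)⁻¹ʳ * (qPochhammer (C y * X) X (m + 1) *
          (qPochhammer X X (m + 1))⁻¹ʳ * (C z * X) ^ (m + 1)) := by
    simp only [hsucc, partitionSeries_const_mul]
    rw [partitionSeries_count_one_eq (b := fun i => if i ≤ m + 1 then 1 else y)
      (if_pos (Nat.le_add_left 1 m)) (NeZero.ne (m + 1))]
    simp only [prod_map_ite_le, partitionSeries_pow_card_filter, map_pow]
    ring
  simp only [hterm] at h
  have hsum := h.unique hbinomial
  simp only [sum_range_one, hzero, partitionSeries_count_one_eq_zero_pow_sup, qPochhammer_zero,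
    Ring.inverse_one, pow_zero, mul_one] at hsum
  rw [Ring.mul_inverse_rev, map_mul, show C y * C z * X ^ 2 = C y * X * (C z * X) by ring]
  linear_combination hsum

end Partitions

section Deformation

variable {A : Type*} [CommRing A] {q y z : A} (hyz : y * z = 1) (hw : (y + z - 2) ^ 2 = 0)
  (hq : ∀ n, IsUnit (1 - q ^ (n + 1)))
include hyz hw hq

theorem qPochhammer_mul_qPochhammer_mul_one_add_sum_lambertTerm (n : ℕ) :
    qPochhammer (y * q) q n * qPochhammer (z * q) q n *
        (1 + (y + z - 2) * ∑ k ∈ range (n + 1), lambertTerm q k)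
      = qPochhammer q q n ^ 2 := by
  induction n with
  | zero => simp
  | succ n ih =>
    have hfactor : (1 - y * q * q ^ n) * (1 - z * q * q ^ n)
        = (1 - q ^ (n + 1)) ^ 2 * (1 - (y + z - 2) * lambertTerm q (n + 1)) := by
      linear_combination (q ^ (n + 1)) ^ 2 * hyz
        + (y + z - 2) * one_sub_sq_mul_lambertTerm hq n
    rw [qPochhammer_self_succ, qPochhammer_succ, qPochhammer_succ, sum_range_succ, mul_pow, ← ih]
    set S := ∑ k ∈ range (n + 1), lambertTerm q k
    set L := lambertTerm q (n + 1)
    set P := qPochhammer (y * q) q n * qPochhammer (z * q) q n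
    linear_combination P * (1 + (y + z - 2) * (S + L)) * hfactor
      - P * (1 - q ^ (n + 1)) ^ 2 * (L * S + L ^ 2) * hw

theorem isBaileyPair_add_mul_lambertAlpha :
    IsBaileyPair q (fun r => (if r = 0 then 1 else 0) + (y + z - 2) * lambertAlpha q r)
      fun n => (qPochhammer (y * q) q n * qPochhammer (z * q) q n)⁻¹ʳ := by
  intro n
  have h := qPochhammer_mul_qPochhammer_mul_one_add_sum_lambertTerm hyz hw hq n
  have hsq := (isUnit_qPochhammer_self hq n).pow 2
  have hunit := isUnit_of_mul_isUnit_left (h ▸ hsq)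
  have hinv : (qPochhammer (y * q) q n * qPochhammer (z * q) q n)⁻¹ʳ
      = (1 + (y + z - 2) * ∑ k ∈ range (n + 1), lambertTerm q k) * (qPochhammer q q n ^ 2)⁻¹ʳ := by
    rw [Ring.eq_mul_inverse_iff_mul_eq _ _ _ hsq, ← h, ← mul_assoc,
      Ring.inverse_mul_cancel _ hunit, one_mul]
  have hlambert := isBaileyPair_lambertAlpha hq n
  simp only [add_mul, ite_mul, one_mul, zero_mul, sum_add_distrib, mul_assoc, ← mul_sum,
    ← hlambert, sum_ite_eq', mem_range, n.succ_pos, if_true, baileyCoeff_zero_right, ← sq]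
  linear_combination hinv

end Deformation

section DeformedSeries

variable {R : Type*} [CommRing R] [TopologicalSpace R] [IsTopologicalRing R] [T2Space R]

theorem qPochhammerInf_mul_qPochhammerInf_mul_one_add_tsum_lambertTerm {q y z : R⟦X⟧}
    (hyz : y * z = 1) (hw : (y + z - 2) ^ 2 = 0) (hq : X ∣ q) :
    qPochhammerInf (y * q) q * qPochhammerInf (z * q) q *
        (1 + (y + z - 2) * ∑' n, lambertTerm q n)
      = qPochhammerInf q q ^ 2 := by
  have hsum := (summable_of_X_pow_dvd_nat (X_pow_dvd_lambertTerm hq)).hasSum.tendsto_sum_nat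
  have hlim := ((tendsto_qPochhammer hq (y * q)).mul (tendsto_qPochhammer hq (z * q))).mul
    ((((Filter.tendsto_add_atTop_iff_nat 1).2 hsum).const_mul (y + z - 2)).const_add 1)
  simp only [qPochhammer_mul_qPochhammer_mul_one_add_sum_lambertTerm hyz hw
    (isUnit_one_sub_pow_succ hq)] at hlim
  exact tendsto_nhds_unique hlim ((tendsto_qPochhammer hq q).pow 2)

variable {y z : R} (hyz : y * z = 1) (hw : (y + z - 2) ^ 2 = 0)
include hyz hw

theorem partitionSeries_rank_of_sq_eq_zero :
    partitionSeries (fun s => y ^ s.sup * z ^ s.card)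
      = (qPochhammerInf X X)⁻¹ʳ *
        (1 + C (y + z - 2) * ∑' r, X ^ r ^ 2 * lambertAlpha X r) := by
  have hyz' : C y * C z = (1 : R⟦X⟧) := by rw [← map_mul, hyz, map_one]
  have hw' : (C y + C z - 2 : R⟦X⟧) ^ 2 = 0 := by
    simpa only [map_pow, map_sub, map_add, map_ofNat, map_zero] using congrArg C hw
  have hX := dvd_refl (X : R⟦X⟧)
  have hpair := isBaileyPair_add_mul_lambertAlpha hyz' hw' (isUnit_one_sub_pow_succ hX)
  have hterm (k : ℕ) : (C y * (C z * X)) ^ k * X ^ (k * (k - 1)) *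
      (qPochhammer (C z * X) X k * qPochhammer (C y * X) X k)⁻¹ʳ
      = X ^ k ^ 2 * (qPochhammer (C y * X) X k * qPochhammer (C z * X) X k)⁻¹ʳ := by
    have hexp : k + k * (k - 1) = k ^ 2 := by
      rw [Nat.mul_sub_one, ← sq, Nat.add_sub_cancel' (Nat.le_self_pow two_ne_zero k)]
    rw [← mul_assoc, hyz', one_mul, ← pow_add, hexp, mul_comm (qPochhammer (C z * X) X k)]
  have hsum : Summable fun r => X ^ r ^ 2 * lambertAlpha (X : R⟦X⟧) r :=
    summable_of_X_pow_dvd_nat fun r =>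
      (pow_dvd_pow X (Nat.le_self_pow two_ne_zero r)).mul_right _
  rw [partitionSeries_pow_sup_mul_pow_card, ← (hasSum_rogersFine hX (dvd_mul_left X _) _).tsum_eq,
    tsum_congr hterm, hpair.tsum_pow_sq_mul hX]
  refine congrArg _ (HasSum.tsum_eq ?_)
  have h := (hasSum_ite_eq 0 (1 : R⟦X⟧)).add (hsum.hasSum.mul_left (C (y + z - 2)))
  refine (congrArg (HasSum · _) (funext fun r => ?_)).mpr h
  rw [map_sub, map_add, map_ofNat]
  split_ifs with hr
  · simp [hr]
  · ring

theorem partitionSeries_crankWeight_of_sq_eq_zero :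
    partitionSeries (crankWeight y z) = X - C y * X + (qPochhammerInf X X)⁻¹ʳ *
      (1 + C (y + z - 2) * ∑' n, lambertTerm X n) := by
  have hyz' : C y * C z = (1 : R⟦X⟧) := by rw [← map_mul, hyz, map_one]
  have hw' : (C y + C z - 2 : R⟦X⟧) ^ 2 = 0 := by
    simpa only [map_pow, map_sub, map_add, map_ofNat, map_zero] using congrArg C hw
  have hX := dvd_refl (X : R⟦X⟧)
  have hprod := qPochhammerInf_mul_qPochhammerInf_mul_one_add_tsum_lambertTerm hyz' hw' hX
  have hunit := ((isUnit_qPochhammerInf hX (dvd_mul_left X (C y))).mul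
    (isUnit_qPochhammerInf hX (dvd_mul_left X (C z))))
  have hsplit := qPochhammer_mul_qPochhammerInf hX X 1
  rw [qPochhammer_self_succ, qPochhammer_zero, one_mul, zero_add, pow_one, ← sq] at hsplit
  rw [partitionSeries_crankWeight, hyz, map_one, one_mul, ← mul_assoc, hsplit, eq_comm,
    add_right_inj, Ring.eq_mul_inverse_iff_mul_eq _ _ _ hunit]
  simp only [map_sub, map_add, map_ofNat]
  rw [mul_assoc, mul_comm (1 + _), hprod, sq, ← mul_assoc, Ring.inverse_mul_cancel _
    (isUnit_qPochhammerInf hX hX), one_mul]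

end DeformedSeries

section RingHom

variable {A B F : Type*} [CommRing A] [CommRing B] [FunLike F A B] [RingHomClass F A B] (f : F)

theorem map_inverse_of_isUnit {a : A} (ha : IsUnit a) : f a⁻¹ʳ = (f a)⁻¹ʳ := by
  rw [← one_mul (f a)⁻¹ʳ, Ring.eq_mul_inverse_iff_mul_eq _ _ _ (ha.map f), ← map_mul,
    Ring.inverse_mul_cancel _ ha, map_one]

theorem map_unitAlpha (q : A) (r : ℕ) : f (unitAlpha q r) = unitAlpha (f q) r := by
  cases r <;> simp [unitAlpha]

theorem map_lambertTerm {q : A} (hq : ∀ n, IsUnit (1 - q ^ (n + 1))) (n : ℕ) :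
    f (lambertTerm q n) = lambertTerm (f q) n := by
  cases n with
  | zero => simp
  | succ n => simp [lambertTerm, map_inverse_of_isUnit f ((hq n).pow 2)]

theorem map_lambertAlpha {q : A} (hq : ∀ n, IsUnit (1 - q ^ (n + 1))) (r : ℕ) :
    f (lambertAlpha q r) = lambertAlpha (f q) r := by
  simp only [lambertAlpha, map_neg, map_mul, map_unitAlpha, map_lambertTerm f hq]

end RingHom

section ContinuousRingHom

variable {R S : Type*} [CommRing R] [TopologicalSpace R] [CommRing S] [TopologicalSpace S]

theorem continuous_map_powerSeries {f : R →+* S} (hf : Continuous f) :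
    Continuous (PowerSeries.map f) := by
  refine continuous_iff_continuousAt.2 fun g => ?_
  rw [ContinuousAt, WithPiTopology.tendsto_iff_coeff_tendsto]
  intro d
  simp only [coeff_map]
  exact (hf.comp (WithPiTopology.continuous_coeff R d)).tendsto g

theorem continuous_expand (p : ℕ) (hp : p ≠ 0) : Continuous (expand p hp : R⟦X⟧ →ₐ[R] R⟦X⟧) := by
  refine continuous_iff_continuousAt.2 fun g => ?_
  rw [ContinuousAt, WithPiTopology.tendsto_iff_coeff_tendsto]
  intro d
  simp only [coeff_expand]
  split_ifs
  · exact (WithPiTopology.continuous_coeff R (d / p)).tendsto g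
  · exact tendsto_const_nhds

variable {F : Type*} [FunLike F R⟦X⟧ S⟦X⟧] [RingHomClass F R⟦X⟧ S⟦X⟧] [T2Space S]
  {f : F} (hf : Continuous f) {q : R⟦X⟧} (hq : X ∣ q)
include hf hq

theorem map_qPochhammerInf (a : R⟦X⟧) :
    f (qPochhammerInf a q) = qPochhammerInf (f a) (f q) := by
  rw [qPochhammerInf, (multipliable_qPochhammer hq a).map_tprod f hf, qPochhammerInf]
  simp only [map_sub, map_mul, map_pow, map_one]

theorem map_tsum_lambertTerm :
    f (∑' n, lambertTerm q n) = ∑' n, lambertTerm (f q) n := by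
  rw [(summable_of_X_pow_dvd_nat (X_pow_dvd_lambertTerm hq)).map_tsum f hf]
  simp only [map_lambertTerm f (isUnit_one_sub_pow_succ hq)]

theorem map_tsum_pow_sq_mul_lambertAlpha :
    f (∑' r, q ^ r ^ 2 * lambertAlpha q r) = ∑' r, f q ^ r ^ 2 * lambertAlpha (f q) r := by
  have hdvd (r : ℕ) : X ^ r ∣ q ^ r ^ 2 * lambertAlpha q r :=
    ((pow_dvd_pow_of_dvd hq r).trans (pow_dvd_pow q (Nat.le_self_pow two_ne_zero r))).mul_right _
  rw [(summable_of_X_pow_dvd_nat hdvd).map_tsum f hf]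
  simp only [map_mul, map_pow, map_lambertAlpha f (isUnit_one_sub_pow_succ hq)]

variable [IsTopologicalRing R] [T2Space R]

theorem map_inverse_qPochhammerInf_self :
    f (qPochhammerInf q q)⁻¹ʳ = (qPochhammerInf (f q) (f q))⁻¹ʳ := by
  rw [map_inverse_of_isUnit f (isUnit_qPochhammerInf hq hq), map_qPochhammerInf hf hq]

end ContinuousRingHom

section Moments

open Nat.Partition

theorem finsum_sq_mul_card {n : ℕ} (g : n.Partition → ℤ) :
    ∑ᶠ m : ℤ, m ^ 2 * ((univ.filter fun p => g p = m).card : ℤ) = ∑ p, g p ^ 2 := by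
  rw [finsum_eq_sum_of_support_subset (s := univ.image g), sum_comp (fun m => m ^ 2) g]
  · exact sum_congr rfl fun m _ => by rw [nsmul_eq_mul, mul_comm]
  · refine Function.support_subset_iff'.2 fun m hm => ?_
    have hempty : univ.filter (fun p => g p = m) = ∅ := by simpa [filter_eq_empty_iff] using hm
    rw [hempty, card_empty, Nat.cast_zero, mul_zero]

theorem rankMoment2_eq_sum (n : ℕ) : rankMoment2 n = ∑ p : n.Partition, p.rank ^ 2 :=
  finsum_sq_mul_card _

theorem crankMoment2_one : crankMoment2 1 = 2 := by
  rw [crankMoment2, finsum_eq_sum_of_support_subset (s := {1, -1})]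
  · simp [crankCount]
  · refine Function.support_subset_iff'.2 fun m hm => ?_
    have hm' : ¬ (m = 1 ∨ m = -1) := by simpa using hm
    by_cases h0 : m = 0 <;> simp [crankCount, h0, hm']

theorem crank_partition_one (p : Nat.Partition 1) : p.crank = -1 := by
  rw [Subsingleton.elim p (Nat.Partition.indiscrete 1)]
  simp [crank, Nat.Partition.indiscrete]

/-- The only partition of `1` has crank `-1`, whereas the convention for `M(m, 1)` makes the second
moment equal to `2`. -/
theorem crankMoment2_eq_sum_add (n : ℕ) :
    crankMoment2 n = ∑ p : n.Partition, p.crank ^ 2 + if n = 1 then 1 else 0 := by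
  split_ifs with hn
  · subst hn
    simp [crankMoment2_one, crank_partition_one]
  · simp only [crankMoment2, crankCount, if_neg hn, finsum_sq_mul_card, add_zero]

theorem rankMoment2_zero : rankMoment2 0 = 0 := by
  rw [rankMoment2_eq_sum]
  simp [rank, largestPart]

theorem crankMoment2_zero : crankMoment2 0 = 0 := by
  rw [crankMoment2_eq_sum_add]
  simp [crank, largestPart]

end Moments

section MomentForm

variable {A R : Type*} [CommRing A] [CommRing R] [Algebra A R]

/-- A linear form which sends `y ^ a * z ^ b` to `(a - b) ^ 2`, and thus turns the two-variable
generating function of a statistic into the generating function of its second moments. -/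
structure IsMomentForm (φ : R →ₗ[A] A) (y z : R) : Prop where
  mul_eq_one : y * z = 1
  sq_eq_zero : (y + z - 2) ^ 2 = 0
  apply_pow_mul_pow : ∀ a b : ℕ, φ (y ^ a * z ^ b) = ((a : A) - b) ^ 2

namespace IsMomentForm

variable {φ : R →ₗ[A] A} {y z : R} (h : IsMomentForm φ y z)
include h

theorem apply_pow_left (a : ℕ) : φ (y ^ a) = (a : A) ^ 2 := by
  simpa using h.apply_pow_mul_pow a 0

theorem apply_one : φ 1 = 0 := by
  simpa using h.apply_pow_left 0

theorem apply_left : φ y = 1 := by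
  simpa using h.apply_pow_left 1

theorem apply_add_sub_two : φ (y + z - 2) = 2 := by
  have hz : φ z = 1 := by simpa using h.apply_pow_mul_pow 0 1
  rw [← one_add_one_eq_two, map_sub, map_add, map_add, h.apply_left, hz, h.apply_one, add_zero,
    sub_zero, one_add_one_eq_two]

theorem apply_coeff_map_mul (U V : A⟦X⟧) (n : ℕ) :
    φ (coeff n (PowerSeries.map (algebraMap A R) U *
        (1 + C (y + z - 2) * PowerSeries.map (algebraMap A R) V))) = coeff n (2 * (U * V)) := by
  rw [mul_one_add, mul_left_comm, ← map_mul, map_add, coeff_C_mul, coeff_map, coeff_map,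
    Algebra.algebraMap_eq_smul_one, mul_comm _ (algebraMap A R _), ← Algebra.smul_def, map_add,
    map_smul, map_smul, h.apply_one, h.apply_add_sub_two, smul_zero, zero_add, smul_eq_mul,
    mul_comm, ← map_ofNat C 2, coeff_C_mul]

theorem apply_crankWeight {n : ℕ} (p : n.Partition) :
    φ (crankWeight y z p.parts) = (p.crank : A) ^ 2 := by
  rw [crankWeight, Nat.Partition.crank, Nat.Partition.largestPart]
  split_ifs
  · rw [h.apply_pow_left, Int.cast_natCast]
  · rw [h.apply_pow_mul_pow, Int.cast_sub, Int.cast_natCast, Int.cast_natCast]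

theorem apply_coeff_X_sub_C_mul_X (n : ℕ) :
    φ (coeff n (X - C y * X)) = -if n = 1 then 1 else 0 := by
  rw [map_sub, coeff_C_mul, coeff_X]
  split_ifs <;> simp [h.apply_one, h.apply_left]

variable [TopologicalSpace A] [IsTopologicalRing A] [T2Space A]
  [TopologicalSpace R] [IsTopologicalRing R] [T2Space R] [ContinuousSMul A R]

theorem mk_rankMoment2 : (PowerSeries.mk fun n => (rankMoment2 n : A))
    = 2 * ((qPochhammerInf X X)⁻¹ʳ * ∑' r, X ^ r ^ 2 * lambertAlpha X r) := by
  have hf := continuous_map_powerSeries (continuous_algebraMap A R)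
  have hX := dvd_refl (X : A⟦X⟧)
  have hseries := partitionSeries_rank_of_sq_eq_zero h.mul_eq_one h.sq_eq_zero
  rw [← map_X (algebraMap A R), ← map_inverse_qPochhammerInf_self hf hX,
    ← map_tsum_pow_sq_mul_lambertAlpha hf hX] at hseries
  ext n
  rw [coeff_mk, ← h.apply_coeff_map_mul, ← hseries, coeff_partitionSeries, map_sum,
    rankMoment2_eq_sum]
  simp only [h.apply_pow_mul_pow]
  push_cast [Nat.Partition.rank]
  rfl

theorem mk_crankMoment2 : (PowerSeries.mk fun n => (crankMoment2 n : A))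
    = 2 * ((qPochhammerInf X X)⁻¹ʳ * ∑' n, lambertTerm X n) := by
  have hf := continuous_map_powerSeries (continuous_algebraMap A R)
  have hX := dvd_refl (X : A⟦X⟧)
  have hseries := partitionSeries_crankWeight_of_sq_eq_zero h.mul_eq_one h.sq_eq_zero
  rw [← sub_eq_iff_eq_add', ← map_X (algebraMap A R), ← map_inverse_qPochhammerInf_self hf hX,
    ← map_tsum_lambertTerm hf hX, map_X] at hseries
  ext n
  rw [coeff_mk, ← h.apply_coeff_map_mul, ← hseries, map_sub, map_sub, coeff_partitionSeries,
    map_sum, h.apply_coeff_X_sub_C_mul_X, sub_neg_eq_add, crankMoment2_eq_sum_add]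
  simp only [h.apply_crankWeight]
  push_cast
  rfl

end IsMomentForm

end MomentForm

section MixedCoeff

variable {A : Type*} [CommRing A]

/-- The element `(1 + t ε) (1 + t δ)` of `A[ε, δ] / (ε², δ²)`, an analogue of `exp (t (ε + δ))` that
requires no division by `2`. -/
def biExp (t : A) : DualNumber (DualNumber A) :=
  .inl (.inl 1 + .inr t) + .inr (.inl t + .inr (t ^ 2))

/-- The coefficient of `ε δ`, as a linear form on `A[ε, δ] / (ε², δ²)`. -/
def mixedCoeff : DualNumber (DualNumber A) →ₗ[A] A where
  toFun x := x.snd.snd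
  map_add' _ _ := rfl
  map_smul' _ _ := rfl

theorem mixedCoeff_apply (x : DualNumber (DualNumber A)) : mixedCoeff x = x.snd.snd := rfl

theorem biExp_mul (s t : A) : biExp s * biExp t = biExp (s + t) := by
  ext <;> simp [biExp] <;> ring

theorem biExp_zero : biExp (0 : A) = 1 := by
  ext <;> simp [biExp]

theorem biExp_pow (t : A) (n : ℕ) : biExp t ^ n = biExp (n * t) := by
  induction n with
  | zero => simp [biExp_zero]
  | succ n ih => rw [pow_succ, ih, biExp_mul, Nat.cast_succ, add_one_mul]

theorem biExp_one_add_biExp_neg_one_sub_two :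
    biExp (1 : A) + biExp (-1) - 2 = .inr (.inr 2) := by
  rw [← one_add_one_eq_two, ← biExp_zero, ← one_add_one_eq_two]
  ext <;> simp [biExp]

theorem isMomentForm_mixedCoeff :
    IsMomentForm (A := A) (R := DualNumber (DualNumber A)) mixedCoeff (biExp 1) (biExp (-1)) where
  mul_eq_one := by rw [biExp_mul, add_neg_cancel, biExp_zero]
  sq_eq_zero := by rw [biExp_one_add_biExp_neg_one_sub_two, sq, TrivSqZeroExt.inr_mul_inr]
  apply_pow_mul_pow a b := by
    rw [biExp_pow, biExp_pow, biExp_mul, mul_one, mul_neg_one, ← sub_eq_add_neg]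
    simp [mixedCoeff_apply, biExp]

end MixedCoeff

section EvenBaileyPairs

variable {R : Type*} [CommRing R] [TopologicalSpace R]

theorem tsum_evenSeq_mul (a f : ℕ → R⟦X⟧) :
    ∑' r, evenSeq a r * f r = ∑' s, a s * f (2 * s) := by
  rw [← (mul_right_injective₀ (two_ne_zero (α := ℕ))).tsum_eq]
  · simp [evenSeq]
  · refine Function.support_subset_iff'.2 fun r hr => ?_
    have hodd : ¬ Even r := fun ⟨s, hs⟩ => hr ⟨s, by simp [hs, two_mul]⟩
    rw [evenSeq, if_neg hodd, zero_mul]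

variable [IsTopologicalRing R] [T2Space R] {q : R⟦X⟧} (hq : X ∣ q)
include hq

theorem qPochhammerInf_mul_inverse_qPochhammerInf (n : ℕ) :
    qPochhammerInf (q ^ (2 * n + 1)) (q ^ 2) * (qPochhammerInf (q ^ (n + 1)) q)⁻¹ʳ
      = (qPochhammerInf (q ^ 2) (q ^ 2))⁻¹ʳ *
        (qPochhammer q q n * (qPochhammer q (q ^ 2) n)⁻¹ʳ) := by
  have hq2 : X ∣ q ^ 2 := hq.trans (dvd_pow_self q two_ne_zero)
  have hprod := qPochhammer_mul_qPochhammerInf hq2 q n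
  have hprod' := qPochhammer_mul_qPochhammerInf hq q n
  have hsplit := qPochhammerInf_eq_mul_sq hq q
  rw [← pow_mul, ← pow_succ'] at hprod
  rw [← pow_succ'] at hprod'
  rw [← sq] at hsplit
  have hcancel := Ring.mul_inverse_cancel _ (isUnit_qPochhammer_of_X_dvd hq (q ^ 2) n)
  rw [eq_comm, Ring.eq_mul_inverse_iff_mul_eq _ _ _
      (isUnit_qPochhammerInf hq (hq.trans (dvd_pow_self q n.succ_ne_zero))), mul_assoc,
    Ring.inverse_mul_eq_iff_eq_mul _ _ _ (isUnit_qPochhammerInf hq2 hq2)]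
  linear_combination (qPochhammer q (q ^ 2) n)⁻¹ʳ *
      (hprod' + hsplit - qPochhammerInf (q ^ 2) (q ^ 2) * hprod) +
    qPochhammerInf (q ^ 2) (q ^ 2) * qPochhammerInf (q ^ (2 * n + 1)) (q ^ 2) * hcancel

theorem IsBaileyPair.hasSum_evenSeq {a c : ℕ → R⟦X⟧} (ha : a 0 = 1)
    (h : IsBaileyPair q (evenSeq a)
      fun n => c n * (qPochhammer q q n * qPochhammer q (q ^ 2) n)⁻¹ʳ) :
    HasSum (fun n => c n * q ^ n * qPochhammerInf (q ^ (2 * n + 1)) (q ^ 2) *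
        ((1 - q ^ n) ^ 2 * qPochhammerInf (q ^ (n + 1)) q)⁻¹ʳ)
      ((qPochhammerInf (q ^ 2) (q ^ 2))⁻¹ʳ *
        (∑' n, lambertTerm q n + ∑' s, a s * lambertTerm (q ^ 2) s)) := by
  have hterm (n : ℕ) : c n * q ^ n * qPochhammerInf (q ^ (2 * n + 1)) (q ^ 2) *
        ((1 - q ^ n) ^ 2 * qPochhammerInf (q ^ (n + 1)) q)⁻¹ʳ
      = (qPochhammerInf (q ^ 2) (q ^ 2))⁻¹ʳ * (qPochhammer q q n ^ 2 * lambertTerm q n *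
        (c n * (qPochhammer q q n * qPochhammer q (q ^ 2) n)⁻¹ʳ)) := by
    have hunit := isUnit_qPochhammer_of_X_dvd hq q n
    have hcancel := Ring.mul_inverse_cancel _ hunit
    rw [Ring.inverse_mul (.inr (isUnit_qPochhammerInf hq
      (hq.trans (dvd_pow_self q n.succ_ne_zero)))), Ring.inverse_mul (.inl hunit), lambertTerm]
    linear_combination c n * q ^ n * ((1 - q ^ n) ^ 2)⁻¹ʳ *
      (qPochhammerInf_mul_inverse_qPochhammerInf hq n - (qPochhammerInf (q ^ 2) (q ^ 2))⁻¹ʳ *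
        qPochhammer q q n * (qPochhammer q (q ^ 2) n)⁻¹ʳ * hcancel)
  have htsum := h.tsum_qPochhammer_sq_mul_lambertTerm_mul hq
  rw [tsum_evenSeq_mul, evenSeq, if_pos Even.zero, Nat.zero_div, ha, one_mul] at htsum
  simp only [hterm, lambertTerm_pow, ← htsum]
  exact (summable_of_X_pow_dvd_nat fun n =>
    ((X_pow_dvd_lambertTerm hq n).mul_left _).mul_right _).hasSum.mul_left _

theorem hasSum_pow_mul_qPochhammerInf :
    HasSum (fun n => q ^ n * qPochhammerInf (q ^ (2 * n + 1)) (q ^ 2) *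
        ((1 - q ^ n) ^ 2 * qPochhammerInf (q ^ (n + 1)) q)⁻¹ʳ)
      ((qPochhammerInf (q ^ 2) (q ^ 2))⁻¹ʳ * ∑' n, lambertTerm q n -
        (qPochhammerInf (q ^ 2) (q ^ 2))⁻¹ʳ *
          ∑' s, (q ^ 2) ^ s ^ 2 * lambertAlpha (q ^ 2) s) := by
  have hpair := isBaileyPair_evenSeq_mul_unitAlpha (isUnit_one_sub_pow_succ hq)
  have h := IsBaileyPair.hasSum_evenSeq (c := fun _ => 1)
    (a := fun s => (q ^ 2) ^ s ^ 2 * unitAlpha (q ^ 2) s) hq (by simp [unitAlpha])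
    (by simpa only [one_mul] using hpair)
  simpa only [one_mul, lambertAlpha, mul_neg, tsum_neg, sub_neg_eq_add, mul_add, mul_assoc] using h

theorem hasSum_pow_triangle_mul_qPochhammerInf :
    HasSum (fun n => q ^ (n * (n + 1) / 2) * qPochhammerInf (q ^ (2 * n + 1)) (q ^ 2) *
        ((1 - q ^ n) ^ 2 * qPochhammerInf (q ^ (n + 1)) q)⁻¹ʳ)
      ((qPochhammerInf (q ^ 2) (q ^ 2))⁻¹ʳ * ∑' n, lambertTerm q n -
        (qPochhammerInf (q ^ 2) (q ^ 2))⁻¹ʳ * ∑' n, lambertTerm (q ^ 2) n) := by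
  have h := IsBaileyPair.hasSum_evenSeq hq (by rfl)
    (isBaileyPair_evenSeq_unitAlpha (isUnit_one_sub_pow_succ hq))
  have htriangle (n : ℕ) : n.choose 2 + n = n * (n + 1) / 2 := by
    rw [Nat.choose_two_right, ← Nat.triangle_succ, Nat.add_sub_cancel, mul_comm]
  rw [tsum_unitAlpha_mul_lambertTerm (hq.trans (dvd_pow_self q two_ne_zero)), ← sub_eq_add_neg,
    mul_sub] at h
  simpa only [← pow_add, htriangle] using h

end EvenBaileyPairs

section SquaredVariable

variable {A : Type*} [CommRing A] [TopologicalSpace A]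

theorem hasSum_intCast_mul_X_pow (c : ℕ → ℤ) {p : ℕ} (hp : p ≠ 0) :
    HasSum (fun n => (c n : A⟦X⟧) * X ^ (p * n)) (expand p hp (mk fun n => (c n : A))) := by
  have h := (hasSum_of_monomials_self (mk fun n => (c n : A))).map (expand p hp)
    (continuous_expand p hp)
  convert h using 2 with n
  rw [Function.comp_apply, coeff_mk, expand_monomial, monomial_eq_C_mul_X_pow, map_intCast]

variable [IsTopologicalRing A] [T2Space A]

theorem hasSum_rankMoment2_mul_X_pow :
    HasSum (fun n => (rankMoment2 n : A⟦X⟧) * X ^ (2 * n))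
      (2 * ((qPochhammerInf (X ^ 2) (X ^ 2))⁻¹ʳ *
        ∑' r, (X ^ 2) ^ r ^ 2 * lambertAlpha (X ^ 2) r)) := by
  have hf := continuous_expand (R := A) 2 two_ne_zero
  have h := hasSum_intCast_mul_X_pow (A := A) rankMoment2 two_ne_zero
  rwa [isMomentForm_mixedCoeff.mk_rankMoment2, map_mul, map_mul, map_ofNat,
    map_inverse_qPochhammerInf_self hf dvd_rfl, map_tsum_pow_sq_mul_lambertAlpha hf dvd_rfl,
    expand_X] at h

theorem hasSum_crankMoment2_mul_X_pow :
    HasSum (fun n => (crankMoment2 n : A⟦X⟧) * X ^ (2 * n))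
      (2 * ((qPochhammerInf (X ^ 2) (X ^ 2))⁻¹ʳ * ∑' n, lambertTerm (X ^ 2) n)) := by
  have hf := continuous_expand (R := A) 2 two_ne_zero
  have h := hasSum_intCast_mul_X_pow (A := A) crankMoment2 two_ne_zero
  rwa [isMomentForm_mixedCoeff.mk_crankMoment2, map_mul, map_mul, map_ofNat,
    map_inverse_qPochhammerInf_self hf dvd_rfl, map_tsum_lambertTerm hf dvd_rfl, expand_X] at h

end SquaredVariable

section Field

theorem inv_eq_inverse {k : Type*} [Field k] (f : k⟦X⟧) : f⁻¹ = f⁻¹ʳ := by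
  by_cases hf : constantCoeff f = 0
  · have hunit : ¬ IsUnit f := by rwa [isUnit_iff_constantCoeff, isUnit_iff_ne_zero, not_not]
    rw [Ring.inverse_non_unit f hunit, PowerSeries.inv_eq_zero.2 hf]
  · rw [inv_eq_iff_mul_eq_one hf, Ring.inverse_mul_cancel]
    rwa [isUnit_iff_constantCoeff, isUnit_iff_ne_zero]

theorem hasSum_pnat_of_hasSum {G : Type*} [AddCommGroup G] [TopologicalSpace G]
    [IsTopologicalAddGroup G] {f : ℕ → G} {a : G} (h : HasSum f a) (h0 : f 0 = 0) :
    HasSum (fun n : ℕ+ => f n) a :=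
  hasSum_pnat_iff.2 (by rwa [h0, add_zero])

theorem qPochInf_eq_qPochhammerInf (a b : ℚ⟦X⟧) : qPochInf a b = qPochhammerInf a b := rfl

theorem C_half_mul_two_mul (f : ℚ⟦X⟧) : C (1 / 2 : ℚ) * (2 * f) = f := by
  rw [← map_ofNat C 2, ← mul_assoc, ← map_mul, one_div_mul_cancel two_ne_zero, map_one, one_mul]

end Field

theorem theorem1 :
    -- the series on the right-hand sides converge in `ℚ⟦X⟧`
    Summable (fun n : ℕ+ =>
      ((n : ℕ) : ℚ⟦X⟧) * (X : ℚ⟦X⟧) ^ (n : ℕ) * (1 - X ^ (n : ℕ))⁻¹) ∧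
    Summable (fun n : ℕ+ => (rankMoment2 n : ℚ⟦X⟧) * X ^ (2 * (n : ℕ))) ∧
    Summable (fun n : ℕ+ => (crankMoment2 n : ℚ⟦X⟧) * X ^ (2 * (n : ℕ))) ∧
    -- the identity with the rank moment
    HasSum
      (fun n : ℕ+ => (X : ℚ⟦X⟧) ^ (n : ℕ) * qPochInf (X ^ (2 * (n : ℕ) + 1)) (X ^ 2) *
        ((1 - X ^ (n : ℕ)) ^ 2 * qPochInf (X ^ ((n : ℕ) + 1)) X)⁻¹)
      ((qPochInf (X ^ 2) (X ^ 2))⁻¹ *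
          (∑' n : ℕ+, ((n : ℕ) : ℚ⟦X⟧) * (X : ℚ⟦X⟧) ^ (n : ℕ) * (1 - X ^ (n : ℕ))⁻¹) -
        C (1 / 2 : ℚ) * ∑' n : ℕ+, (rankMoment2 n : ℚ⟦X⟧) * X ^ (2 * (n : ℕ))) ∧
    -- the identity with the crank moment
    HasSum
      (fun n : ℕ+ => (X : ℚ⟦X⟧) ^ ((n : ℕ) * ((n : ℕ) + 1) / 2) *
        qPochInf (X ^ (2 * (n : ℕ) + 1)) (X ^ 2) *
        ((1 - X ^ (n : ℕ)) ^ 2 * qPochInf (X ^ ((n : ℕ) + 1)) X)⁻¹)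
      ((qPochInf (X ^ 2) (X ^ 2))⁻¹ *
          (∑' n : ℕ+, ((n : ℕ) : ℚ⟦X⟧) * (X : ℚ⟦X⟧) ^ (n : ℕ) * (1 - X ^ (n : ℕ))⁻¹) -
        C (1 / 2 : ℚ) * ∑' n : ℕ+, (crankMoment2 n : ℚ⟦X⟧) * X ^ (2 * (n : ℕ))) := by
  simp only [inv_eq_inverse, qPochInf_eq_qPochhammerInf]
  have hL := hasSum_pnat_of_hasSum
    (hasSum_mul_pow_mul_inverse_one_sub (R := ℚ) (q := X) dvd_rfl) (by simp)
  have hN := hasSum_pnat_of_hasSum (hasSum_rankMoment2_mul_X_pow (A := ℚ))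
    (by rw [rankMoment2_zero, Int.cast_zero, zero_mul])
  have hM := hasSum_pnat_of_hasSum (hasSum_crankMoment2_mul_X_pow (A := ℚ))
    (by rw [crankMoment2_zero, Int.cast_zero, zero_mul])
  refine ⟨hL.summable, hN.summable, hM.summable, ?_, ?_⟩
  · rw [hL.tsum_eq, hN.tsum_eq, C_half_mul_two_mul]
    exact hasSum_pnat_of_hasSum
      (hasSum_pow_mul_qPochhammerInf (R := ℚ) (q := X) dvd_rfl) (by simp)
  · rw [hL.tsum_eq, hM.tsum_eq, C_half_mul_two_mul]
    exact hasSum_pnat_of_hasSum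
      (hasSum_pow_triangle_mul_qPochhammerInf (R := ℚ) (q := X) dvd_rfl) (by simp)
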